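/- Define $\phi:\mathbb Z^2\to\mathbb C$ by $$\phi=\frac1{3840000}\left(\frac1{12}\phi_1+\frac18\phi_2+\frac13\phi_3\right),$$ where $\phi_1,\phi_2,\phi_3:\mathbb Z^2\to\mathbb C$ vanish outside of the points listed here (upper signs go with upper signs, lower with lower): $\phi_1(0,0)=41375061$, $\phi_1(\pm(1,0))=1080000\pm969232\,i$, $\phi_1(\pm(2,0))=-165072$, $\phi_1(\mp(3,0))=72000\pm9024\,i$, $\phi_1(\pm(4,0))=-38256$; $\phi_2(0,\pm1)=1228800$, $\phi_2(0,\pm2)=-286328$, $\phi_2(0,\pm4)=-9524$, $\phi_2(0,\pm6)=2232$, $\phi_2(0,\pm8)=-179$; $\phi_3(\mp1,1)=\phi_3(\mp1,-1)=\pm115200\,i$, $\phi_3(\mp1,2)=\phi_3(\mp1,-2)=\pm6939\,i$, $\phi_3(\pm2,2)=\phi_3(\pm2,-2)=216$, $\phi_3(\pm3,2)=\phi_3(\pm3,-2)=\pm1128\,i$, $\phi_3(\pm1,4)=\phi_3(\pm1,-4)=\pm1062\,i$, $\phi_3(\pm2,4)=\phi_3(\pm2,-4)=-54$, $\phi_3(\mp1,6)=\phi_3(\mp1,-6)=\pm77\,i$.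 Let $\phi^{(1)}=\phi$ and $\phi^{(n)}(x)=\sum_{y\in\mathbb Z^2}\phi^{(n-1)}(x-y)\phi(y)$ for $n\ge2$ be the convolution powers of $\phi$, and let $\|\phi^{(n)}\|_\infty=\sup_{x\in\mathbb Z^2}|\phi^{(n)}(x)|$. Let $P(\xi)=(\eta+\zeta^2)^2+\eta^4$ for $\xi=(\eta,\zeta)\in\mathbb R^2$, and, for $t>0$ and $x\in\mathbb R^2$, let $$H_P^t(x)=\frac1{(2\pi)^2}\int_{\mathbb R^2}e^{-tP(\xi)}e^{-ix\cdot\xi}\,d\xi .$$ Then: 1. for every $t>0$ the function $e^{-tP}$ is integrable on $\mathbb R^2$, so that $H_P^t$ is well defined; 2. $\phi^{(n)}(x)=H_P^{n/100}(x)+o(n^{-5/8})$ uniformly for $x\in\mathbb Z^2$ as $n\to\infty$, i.e. for every $\epsilon>0$ there is $N$ such that $|\phi^{(n)}(x)-H_P^{n/100}(x)|<\epsilon n^{-5/8}$ for all $n\ge N$ and all $x\in\mathbb Z^2$; 3. $\|\phi^{(n)}\|_\infty\asymp n^{-5/8}$ for $n\ge1$, i.e. there are constants $C,C'>0$ with $Cn^{-5/8}\le\|\phi^{(n)}\|_\infty\le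 C'n^{-5/8}$ for all integers $n\ge1$; 4. $\displaystyle\lim_{n\to\infty}n^{5/8}\|\phi^{(n)}\|_\infty=\frac{100^{5/8}}{2\pi^{3/2}}\,\Gamma(9/8).$ -/

import Mathlib

open Filter Topology MeasureTheory

noncomputable section

/-- The iterated convolution powers of `f : ℤ² → ℂ`: the first power is `f`, and
`f^(n) (x) = ∑_{y ∈ ℤ²} f^(n-1) (x - y) f y` for `n ≥ 2`. (The zeroth power, which is not used,
is set to be the unit of convolution.) -/
def convPow (f : ℤ × ℤ → ℂ) : ℕ → ℤ × ℤ → ℂ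
  | 0 => fun x => if x = 0 then 1 else 0
  | 1 => f
  | n + 2 => fun x => ∑' y : ℤ × ℤ, convPow f (n + 1) (x - y) * f y

/-- The supremum norm `‖f‖_∞ = sup_{x ∈ ℤ²} |f x|` of a (bounded) function on `ℤ²`. -/
def supNorm (f : ℤ × ℤ → ℂ) : ℝ := ⨆ x : ℤ × ℤ, ‖f x‖

/-- The heat kernel with symbol `P`:
`H_P^t (x) = (2π)⁻² ∫_{ℝ²} e^{-t P(ξ)} e^{-i x·ξ} dξ`. -/
def heatKernel (P : ℝ × ℝ → ℝ) (t : ℝ) (x : ℝ × ℝ) : ℂ :=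
  1 / (2 * (Real.pi : ℂ)) ^ 2 *
    ∫ ξ : ℝ × ℝ, Complex.exp (-((t * P ξ : ℝ) : ℂ)) *
      Complex.exp (-(Complex.I * ((x.1 * ξ.1 + x.2 * ξ.2 : ℝ) : ℂ)))

/-- The symbol `P(η, ζ) = (η + ζ²)² + η⁴`. -/
def symbolP (ξ : ℝ × ℝ) : ℝ := (ξ.1 + ξ.2 ^ 2) ^ 2 + ξ.1 ^ 4

def phi₁ (x : ℤ × ℤ) : ℂ :=
  if x = (0, 0) then 41375061
  else if x = (1, 0) then 1080000 + 969232 * Complex.I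
  else if x = (-1, 0) then 1080000 - 969232 * Complex.I
  else if x = (2, 0) ∨ x = (-2, 0) then -165072
  else if x = (-3, 0) then 72000 + 9024 * Complex.I
  else if x = (3, 0) then 72000 - 9024 * Complex.I
  else if x = (4, 0) ∨ x = (-4, 0) then -38256
  else 0

def phi₂ (x : ℤ × ℤ) : ℂ :=
  if x = (0, 1) ∨ x = (0, -1) then 1228800
  else if x = (0, 2) ∨ x = (0, -2) then -286328
  else if x = (0, 4) ∨ x = (0, -4) then -9524
  else if x = (0, 6) ∨ x = (0, -6) then 2232
  else if x = (0, 8) ∨ x = (0, -8) then -179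
  else 0

def phi₃ (x : ℤ × ℤ) : ℂ :=
  if x = (-1, 1) ∨ x = (-1, -1) then 115200 * Complex.I
  else if x = (1, 1) ∨ x = (1, -1) then -115200 * Complex.I
  else if x = (-1, 2) ∨ x = (-1, -2) then 6939 * Complex.I
  else if x = (1, 2) ∨ x = (1, -2) then -6939 * Complex.I
  else if x = (2, 2) ∨ x = (2, -2) ∨ x = (-2, 2) ∨ x = (-2, -2) then 216
  else if x = (3, 2) ∨ x = (3, -2) then 1128 * Complex.I
  else if x = (-3, 2) ∨ x = (-3, -2) then -1128 * Complex.I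
  else if x = (1, 4) ∨ x = (1, -4) then 1062 * Complex.I
  else if x = (-1, 4) ∨ x = (-1, -4) then -1062 * Complex.I
  else if x = (2, 4) ∨ x = (2, -4) ∨ x = (-2, 4) ∨ x = (-2, -4) then -54
  else if x = (-1, 6) ∨ x = (-1, -6) then 77 * Complex.I
  else if x = (1, 6) ∨ x = (1, -6) then -77 * Complex.I
  else 0

/-- The explicit finitely supported function `φ : ℤ² → ℂ`. -/
def phi (x : ℤ × ℤ) : ℂ :=
  1 / 3840000 * (1 / 12 * phi₁ x + 1 / 8 * phi₂ x + 1 / 3 * phi₃ x)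

theorem phi_support_finite : (Function.support phi).Finite := by
  refine (Set.finite_Icc ((-8, -8) : ℤ × ℤ) (8, 8)).subset fun x hx => ?_
  by_contra h
  have key : ∀ a b : ℤ, -8 ≤ a → a ≤ 8 → -8 ≤ b → b ≤ 8 → x ≠ (a, b) := by
    rintro a b h1 h2 h3 h4 rfl
    exact h ⟨⟨h1, h3⟩, ⟨h2, h4⟩⟩
  apply hx
  simp (discharger := norm_num) only [phi, phi₁, phi₂, phi₃, key, or_self, if_false]
  norm_num

/-- All convolution powers of a finitely supported function are finitely supported; in
particular every series in `convPow phi` is a finite sum. -/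
theorem convPow_support_finite {f : ℤ × ℤ → ℂ} (hf : (Function.support f).Finite) :
    ∀ n : ℕ, (Function.support (convPow f n)).Finite
  | 0 => (Set.finite_singleton (0 : ℤ × ℤ)).subset fun x hx => by
      by_contra h
      exact hx (if_neg h)
  | 1 => hf
  | n + 2 => ((convPow_support_finite hf (n + 1)).add hf).subset fun x hx => by
      by_contra h
      apply hx
      have h0 : ∀ y, convPow f (n + 1) (x - y) * f y = 0 := by
        intro y
        by_contra hy
        exact h (Set.mem_add.2 ⟨x - y, left_ne_zero_of_mul hy, y, right_ne_zero_of_mul hy,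
          sub_add_cancel x y⟩)
      simp only [convPow, h0, tsum_zero]

/-- The supremum defining `supNorm (convPow phi n)` is that of a bounded set. -/
theorem bddAbove_norm_convPow_phi (n : ℕ) :
    BddAbove (Set.range fun x => ‖convPow phi n x‖) := by
  have h := convPow_support_finite phi_support_finite n
  refine (((h.image fun x => ‖convPow phi n x‖).insert 0).subset ?_).bddAbove
  rintro _ ⟨x, rfl⟩
  by_cases hx : convPow phi n x = 0
  · left
    simp [hx]
  · exact Or.inr ⟨x, hx, rfl⟩

end

/-!
Fourier inversion writes `φ^(n)(x)` as `(2π)⁻² ∫ φ̂(ξ)ⁿ e^{-ix·ξ} dξ` over the cell `(-π, π]²`, and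
`H_P^t(x)` is the same integral over `ℝ²` with `e^{-tP}` in place of `φ̂ⁿ`. Hence
`|φ^(n)(x) - H_P^{n/100}(x)|` is bounded, uniformly in `x`, by the `L¹` distance of the two
multipliers (`norm_convPow_sub_heatKernel_le`), and everything reduces to the statement that this
distance is `o(n^{-5/8})`.

The symbol `φ̂ = 1 - defect / 100` is real. Three facts about it are needed.
* `|φ̂| < 1` on the cell away from the origin (`defectPoly_pos`, `defect_lt`). In the variables
  `s = sin η`, `y = 1 - cos ζ` the defect is bounded below by a quadratic in `s` plus a multiple of
  `s⁴`; bounding `s⁴` below by a tangent in `s²`, chosen according to the size of `y`, leaves a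
  quadratic whose discriminant is negative for every `y` in `(0, 2]`.
* Near the origin `defect = P - (η + ζ²)⁴ / 200` up to terms of order five in `|η| + ζ²`
  (`anisoOrder_defect_sub`), while `P` is bounded below there by a multiple of
  `(|η| + ζ²)⁴` (`anisoSize_pow_four_le`).
* Consequently, by compactness, `defect ≥ c P` on the whole cell (`exists_mul_symbolP_le_defect`),
  so that `φ̂ⁿ ≤ e^{-c n P / 100}` there.

The zero set of the leading part `(η + ζ²)²` is a parabola, so no linear rescaling is adapted to
`P`. The substitution `η + ζ² = b⁴ s`, `ζ = b z` with `b = (n/100)^{-1/8}` has constant Jacobian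
`b⁵`, a multiple of `n^{-5/8}`, and turns `n P / 100` into `s² + (b² s - z²)⁴`. This tends
to `s² + z⁸` and is at least `(s² + z²)/2 - 1` (`half_sum_sq_le`). Dominated convergence with a
Gaussian majorant then shows that both rescaled multipliers converge in `L¹` to `e^{-s² - z⁸}`, whose integral is
`2 Γ(9/8) √π`. As `H_P^t` attains its supremum at the origin, this gives the limit of
`n^{5/8} ‖φ^(n)‖_∞`; the two-sided bound for all `n ≥ 1` follows because the norms are positive.
-/

/-! ### Fourier inversion for convolution powers -/

/-- The fundamental cell `(-π, π]²` of the dual group of `ℤ²`. -/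
def torusCell : Set (ℝ × ℝ) := Set.Ioc (-Real.pi) Real.pi ×ˢ Set.Ioc (-Real.pi) Real.pi

/-- The pairing `x · ξ` of a lattice point with a frequency. -/
def latticePairing (x : ℤ × ℤ) (ξ : ℝ × ℝ) : ℝ := x.1 * ξ.1 + x.2 * ξ.2

/-- The Fourier symbol `f̂(ξ) = ∑_{y ∈ ℤ²} f(y) e^{i y·ξ}` of a finitely supported `f`. -/
noncomputable def fourierSymbol (f : ℤ × ℤ → ℂ) (ξ : ℝ × ℝ) : ℂ :=
  ∑' y : ℤ × ℤ, f y * Complex.exp (Complex.I * (latticePairing y ξ : ℂ))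

theorem fourierSymbol_eq_sum {f : ℤ × ℤ → ℂ} {S : Finset (ℤ × ℤ)} (hS : Function.support f ⊆ S)
    (ξ : ℝ × ℝ) :
    fourierSymbol f ξ = ∑ y ∈ S, f y * Complex.exp (Complex.I * (latticePairing y ξ : ℂ)) := by
  refine tsum_eq_sum fun y hy => ?_
  rw [Function.notMem_support.1 fun h => hy (hS h), zero_mul]

theorem continuous_fourierSymbol {f : ℤ × ℤ → ℂ} (hf : (Function.support f).Finite) :
    Continuous (fourierSymbol f) := by
  have h : fourierSymbol f = fun ξ => ∑ y ∈ hf.toFinset,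
      f y * Complex.exp (Complex.I * (latticePairing y ξ : ℂ)) :=
    funext fun ξ => fourierSymbol_eq_sum (by simp) ξ
  rw [h]
  unfold latticePairing
  fun_prop

theorem integrableOn_torusCell {E : Type*} [NormedAddCommGroup E] {g : ℝ × ℝ → E}
    (hg : Continuous g) : IntegrableOn g torusCell := by
  refine (hg.continuousOn.integrableOn_compact
    (isCompact_Icc.prod isCompact_Icc :
      IsCompact (Set.Icc (-Real.pi) Real.pi ×ˢ Set.Icc (-Real.pi) Real.pi))).mono_set ?_
  exact Set.prod_mono Set.Ioc_subset_Icc_self Set.Ioc_subset_Icc_self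

theorem integral_exp_int_mul (k : ℤ) :
    ∫ t in Set.Ioc (-Real.pi) Real.pi, Complex.exp (-(Complex.I * (k * t : ℂ))) =
      if k = 0 then 2 * (Real.pi : ℂ) else 0 := by
  rw [← intervalIntegral.integral_of_le (by linarith [Real.pi_pos])]
  split_ifs with hk
  · subst hk
    simp
    ring
  · have hc : -(Complex.I * k) ≠ 0 := by simp [hk]
    have := integral_exp_mul_complex (a := -Real.pi) (b := Real.pi) hc
    simp only [← mul_assoc, ← neg_mul] at this ⊢
    rw [this, div_eq_zero_iff]
    left
    rw [sub_eq_zero, Complex.exp_eq_exp_iff_exists_int]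
    refine ⟨-k, ?_⟩
    push_cast
    ring

theorem integral_torusCell_exp (x : ℤ × ℤ) :
    ∫ ξ in torusCell, Complex.exp (-(Complex.I * (latticePairing x ξ : ℂ))) =
      if x = 0 then (2 * (Real.pi : ℂ)) ^ 2 else 0 := by
  have h : ∀ ξ : ℝ × ℝ, Complex.exp (-(Complex.I * (latticePairing x ξ : ℂ))) =
      Complex.exp (-(Complex.I * (x.1 * ξ.1 : ℂ))) *
        Complex.exp (-(Complex.I * (x.2 * ξ.2 : ℂ))) := fun ξ => by
    rw [← Complex.exp_add]
    congr 1
    simp only [latticePairing]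
    push_cast
    ring
  simp only [h, torusCell]
  rw [Measure.volume_eq_prod, setIntegral_prod_mul
    (fun t : ℝ => Complex.exp (-(Complex.I * (x.1 * t : ℂ))))
    (fun t : ℝ => Complex.exp (-(Complex.I * (x.2 * t : ℂ)))),
    integral_exp_int_mul, integral_exp_int_mul]
  rcases x with ⟨a, b⟩
  by_cases ha : a = 0 <;> by_cases hb : b = 0 <;> simp [ha, hb, sq]

theorem convPow_succ {f : ℤ × ℤ → ℂ} (n : ℕ) (x : ℤ × ℤ) :
    convPow f (n + 1) x = ∑' y : ℤ × ℤ, convPow f n (x - y) * f y := by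
  cases n with
  | zero =>
    rw [tsum_eq_single x fun y hy => by
      simp [convPow, sub_eq_zero, Ne.symm hy]]
    simp [convPow]
  | succ n => rfl

/-- Fourier inversion: convolution powers are Fourier coefficients of powers of the symbol. -/
theorem convPow_eq_integral {f : ℤ × ℤ → ℂ} (hf : (Function.support f).Finite) (n : ℕ) :
    ∀ x : ℤ × ℤ, convPow f n x = 1 / (2 * (Real.pi : ℂ)) ^ 2 *
      ∫ ξ in torusCell, fourierSymbol f ξ ^ n *
        Complex.exp (-(Complex.I * (latticePairing x ξ : ℂ))) := by
  induction n with
  | zero =>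
    intro x
    have hpi : (Real.pi : ℂ) ≠ 0 := by exact_mod_cast Real.pi_ne_zero
    simp only [pow_zero, one_mul, integral_torusCell_exp, convPow]
    split_ifs
    · field_simp
    · simp
  | succ n ih =>
    intro x
    have hcont := continuous_fourierSymbol hf
    rw [convPow_succ, tsum_eq_sum (s := hf.toFinset) fun y hy => by
      rw [Function.notMem_support.1 fun h => hy (hf.mem_toFinset.2 h), mul_zero]]
    have hstep : ∀ ξ : ℝ × ℝ, fourierSymbol f ξ ^ (n + 1) *
        Complex.exp (-(Complex.I * (latticePairing x ξ : ℂ))) =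
        ∑ y ∈ hf.toFinset, f y * (fourierSymbol f ξ ^ n *
          Complex.exp (-(Complex.I * (latticePairing (x - y) ξ : ℂ)))) := fun ξ => by
      rw [pow_succ, mul_assoc, fourierSymbol_eq_sum (S := hf.toFinset) (by simp) ξ, Finset.sum_mul,
        Finset.mul_sum]
      refine Finset.sum_congr rfl fun y _ => ?_
      have : Complex.exp (-(Complex.I * (latticePairing (x - y) ξ : ℂ))) =
          Complex.exp (Complex.I * (latticePairing y ξ : ℂ)) *
            Complex.exp (-(Complex.I * (latticePairing x ξ : ℂ))) := by
        rw [← Complex.exp_add]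
        congr 1
        simp only [latticePairing, Prod.fst_sub, Prod.snd_sub]
        push_cast
        ring
      rw [this]
      ring
    simp only [hstep]
    rw [integral_finsetSum, Finset.mul_sum]
    · refine Finset.sum_congr rfl fun y _ => ?_
      rw [ih, integral_const_mul]
      ring
    · intro y _
      refine integrableOn_torusCell ?_
      unfold latticePairing
      fun_prop

/-! ### The symbol of `phi` -/

/-- The points outside of which `phi` vanishes. -/
def phiPoints : List (ℤ × ℤ) :=
  [(0, 0), (1, 0), (-1, 0), (2, 0), (-2, 0), (3, 0), (-3, 0), (4, 0), (-4, 0), (0, 1),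
    (0, -1), (0, 2), (0, -2), (0, 4), (0, -4), (0, 6), (0, -6), (0, 8), (0, -8), (1, 1),
    (1, -1), (-1, 1), (-1, -1), (1, 2), (1, -2), (-1, 2), (-1, -2), (2, 2), (2, -2),
    (-2, 2), (-2, -2), (3, 2), (3, -2), (-3, 2), (-3, -2), (1, 4), (1, -4), (-1, 4),
    (-1, -4), (2, 4), (2, -4), (-2, 4), (-2, -4), (1, 6), (1, -6), (-1, 6), (-1, -6)]

theorem support_phi_subset : Function.support phi ⊆ phiPoints.toFinset := by
  intro x hx
  by_contra h
  simp only [phiPoints, List.coe_toFinset, Set.mem_ofPred_eq, List.mem_cons, List.not_mem_nil,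
    or_false, not_or] at h
  apply hx
  simp only [phi, phi₁, phi₂, phi₃, h, or_self, if_false]
  norm_num

/-- `100 (1 - φ̂)` as a polynomial in `q = 1 - cos η`, `s = sin η` and `y = 1 - cos ζ`. -/
noncomputable def defectPoly (q s y : ℝ) : ℝ :=
  2 * q + 647 / 150 * q ^ 2 - 1219 / 300 * q ^ 3 + 797 / 600 * q ^ 4 +
    y * (4 * s + 47 / 75 * s ^ 3) +
    y ^ 2 * (4 + 2 / 3 * s - 3 / 25 * s ^ 2 - 47 / 150 * s ^ 3) +
    y ^ 3 * (4 / 3 + 4 / 225 * s + 3 / 25 * s ^ 2) +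
    y ^ 4 * (29 / 75 - 43 / 50 * s - 3 / 100 * s ^ 2) +
    y ^ 5 * (-283 / 75 + 77 / 150 * s) + y ^ 6 * (256 / 75 - 77 / 900 * s) -
    179 / 150 * y ^ 7 + 179 / 1200 * y ^ 8

/-- Chebyshev identities for `Z = cos θ + i sin θ` and its inverse `W`. -/
theorem sum_pow_of_unit_circle {Z W c d : ℂ} (hZ : Z = c + d * Complex.I)
    (hW : W = c - d * Complex.I) (h : d ^ 2 + c ^ 2 = 1) :
    Z + W = 2 * c ∧ Z - W = 2 * d * Complex.I ∧ Z ^ 2 + W ^ 2 = 4 * c ^ 2 - 2 ∧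
    Z ^ 3 + W ^ 3 = 8 * c ^ 3 - 6 * c ∧ Z ^ 3 - W ^ 3 = (6 * d - 8 * d ^ 3) * Complex.I ∧
    Z ^ 4 + W ^ 4 = 2 * (2 * (2 * c ^ 2 - 1) ^ 2 - 1) ∧
    Z ^ 6 + W ^ 6 = 2 * (4 * (2 * c ^ 2 - 1) ^ 3 - 3 * (2 * c ^ 2 - 1)) ∧
    Z ^ 8 + W ^ 8 = 2 * (2 * (2 * (2 * c ^ 2 - 1) ^ 2 - 1) ^ 2 - 1) := by
  have hI := Complex.I_sq
  have h1 : Z + W = 2 * c := by rw [hZ, hW]; ring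
  have h1' : Z - W = 2 * d * Complex.I := by rw [hZ, hW]; ring
  have hZW : Z * W = 1 := by rw [hZ, hW]; linear_combination h - d ^ 2 * hI
  have h2 : Z ^ 2 + W ^ 2 = 4 * c ^ 2 - 2 := by
    linear_combination (Z + W + 2 * c) * h1 - 2 * hZW
  have h4 : Z ^ 4 + W ^ 4 = 2 * (2 * (2 * c ^ 2 - 1) ^ 2 - 1) := by
    linear_combination (Z ^ 2 + W ^ 2 + 4 * c ^ 2 - 2) * h2 - 2 * (Z * W + 1) * hZW
  refine ⟨h1, h1', h2, ?_, ?_, h4, ?_, ?_⟩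
  · linear_combination (Z ^ 2 + W ^ 2 - Z * W) * h1 + 2 * c * h2 - 2 * c * hZW
  · linear_combination (Z ^ 2 + W ^ 2 + Z * W) * h1' + 2 * d * Complex.I * (h2 + hZW + 4 * h)
  · linear_combination (Z ^ 4 + W ^ 4 - (Z * W) ^ 2) * h2 +
      (4 * c ^ 2 - 2) * (h4 - (Z * W + 1) * hZW)
  · linear_combination (Z ^ 4 + W ^ 4 + 2 * (2 * (2 * c ^ 2 - 1) ^ 2 - 1)) * h4 -
      2 * ((Z * W) ^ 3 + (Z * W) ^ 2 + Z * W + 1) * hZW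

/-- `100 (1 - φ̂(η, ζ))`, a real trigonometric polynomial. -/
noncomputable def defect (ξ : ℝ × ℝ) : ℝ :=
  defectPoly (1 - Real.cos ξ.1) (Real.sin ξ.1) (1 - Real.cos ξ.2)

theorem fourierSymbol_phi (ξ : ℝ × ℝ) : fourierSymbol phi ξ = ((1 - defect ξ / 100 : ℝ) : ℂ) := by
  obtain ⟨η, ζ⟩ := ξ
  rw [fourierSymbol_eq_sum support_phi_subset, List.sum_toFinset _ (by decide)]
  have hexp : ∀ a b : ℤ, Complex.exp (Complex.I * (latticePairing (a, b) (η, ζ) : ℂ)) =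
      Complex.exp (Complex.I * η) ^ a * Complex.exp (Complex.I * ζ) ^ b := fun a b => by
    rw [← Complex.exp_int_mul, ← Complex.exp_int_mul, ← Complex.exp_add]
    congr 1
    simp only [latticePairing]
    push_cast
    ring
  obtain ⟨X, hXe⟩ : ∃ X, X = Complex.exp (Complex.I * η) := ⟨_, rfl⟩
  obtain ⟨Y, hYe⟩ : ∃ Y, Y = Complex.exp (Complex.I * ζ) := ⟨_, rfl⟩
  have hX := hXe
  have hY := hYe
  have hXi : X⁻¹ = Complex.cos η - Complex.sin η * Complex.I := by
    rw [hX, ← Complex.exp_neg, ← mul_neg, mul_comm, Complex.exp_mul_I, Complex.cos_neg,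
      Complex.sin_neg]
    ring
  have hYi : Y⁻¹ = Complex.cos ζ - Complex.sin ζ * Complex.I := by
    rw [hY, ← Complex.exp_neg, ← mul_neg, mul_comm, Complex.exp_mul_I, Complex.cos_neg,
      Complex.sin_neg]
    ring
  rw [mul_comm, Complex.exp_mul_I] at hX hY
  simp only [phiPoints, hexp]
  rw [← hXe, ← hYe]
  simp only [List.map_cons, List.map_nil, List.sum_cons, List.sum_nil, phi, phi₁, phi₂, phi₃,
    Prod.mk.injEq]
  norm_num
  simp only [← inv_pow]
  obtain ⟨a1, b1, a2, a3, b3, a4, -, -⟩ :=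
    sum_pow_of_unit_circle hX hXi (Complex.sin_sq_add_cos_sq η)
  obtain ⟨c1, -, c2, -, -, c4, c6, c8⟩ :=
    sum_pow_of_unit_circle hY hYi (Complex.sin_sq_add_cos_sq ζ)
  have hI := Complex.I_sq
  have hs := Complex.sin_sq_add_cos_sq (η : ℂ)
  simp only [defect, defectPoly]
  push_cast
  generalize Complex.cos (η : ℂ) = k at *
  generalize Complex.sin (η : ℂ) = s at *
  generalize Complex.cos (ζ : ℂ) = c at *
  generalize Complex.sin (ζ : ℂ) = d at *
  generalize X⁻¹ = X' at *
  generalize Y⁻¹ = Y' at *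
  have a2' : X ^ 2 + X' ^ 2 = 2 - 4 * s ^ 2 := by linear_combination a2 + 4 * hs
  clear hX hY hXe hYe hXi hYi hexp
  -- `φ` pairs opposite points, so only the combinations `Xᵃ ± X⁻ᵃ` and `Yᵇ + Y⁻ᵇ` occur; each is
  -- replaced by its expression in `k = cos η`, `s = sin η`, `c = cos ζ`
  linear_combination
    (1 / 46080000) * (1080000 * a1 + 969232 * Complex.I * b1 - 165072 * a2 + 72000 * a3 -
      9024 * Complex.I * b3 - 38256 * a4) +
    (1 / 30720000) * (1228800 * c1 - 286328 * c2 - 9524 * c4 + 2232 * c6 - 179 * c8) +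
    (1 / 11520000) * (
      Complex.I * (X - X') * (-115200 * c1 - 6939 * c2 + 1062 * c4 - 77 * c6) +
      1128 * Complex.I * (X ^ 3 - X' ^ 3) * c2 +
      (X ^ 2 + X' ^ 2) * (216 * c2 - 54 * c4) +
      Complex.I * (-115200 * (2 * c) - 6939 * (4 * c ^ 2 - 2) +
        1062 * (2 * (2 * (2 * c ^ 2 - 1) ^ 2 - 1)) -
        77 * (2 * (4 * (2 * c ^ 2 - 1) ^ 3 - 3 * (2 * c ^ 2 - 1)))) * b1 +
      1128 * Complex.I * (4 * c ^ 2 - 2) * b3 +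
      (216 * (4 * c ^ 2 - 2) - 54 * (2 * (2 * (2 * c ^ 2 - 1) ^ 2 - 1))) * a2') +
    ((1 / 46080000) * (969232 * 2 * s - 9024 * (6 * s - 8 * s ^ 3)) +
     (1 / 11520000) * ((-115200 * (2 * c) - 6939 * (4 * c ^ 2 - 2) +
        1062 * (2 * (2 * (2 * c ^ 2 - 1) ^ 2 - 1)) -
        77 * (2 * (4 * (2 * c ^ 2 - 1) ^ 3 - 3 * (2 * c ^ 2 - 1)))) * (2 * s) +
        1128 * (4 * c ^ 2 - 2) * (6 * s - 8 * s ^ 3))) * hI -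
    9 / 80000 * hs

/-! ### Global bounds for the symbol -/

theorem quadratic_pos_of_sq_lt {A b H : ℝ} (hA : 0 < A) (h : b ^ 2 < 4 * A * H) (s : ℝ) :
    0 < A * s ^ 2 + b * s + H := by
  have : 0 < 4 * A * (A * s ^ 2 + b * s + H) := by nlinarith [sq_nonneg (2 * A * s + b)]
  exact pos_of_mul_pos_right this (by positivity)

/-- The terms of `defectPoly` that depend on `y` only. -/
noncomputable def defectConst (y : ℝ) : ℝ :=
  4 * y ^ 2 + 4 / 3 * y ^ 3 + 29 / 75 * y ^ 4 - 283 / 75 * y ^ 5 + 256 / 75 * y ^ 6 -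
    179 / 150 * y ^ 7 + 179 / 1200 * y ^ 8

/-- The coefficient of the first power of `s` in `defectPoly`. -/
noncomputable def defectLin (y : ℝ) : ℝ :=
  4 * y + 2 / 3 * y ^ 2 + 4 / 225 * y ^ 3 - 43 / 50 * y ^ 4 + 77 / 150 * y ^ 5 - 77 / 900 * y ^ 6

/-- Negativity of the discriminant of the quadratic in `s` that bounds `defectPoly` from below, for
`y ≤ 1/2`. As in the two lemmas that follow, the polynomial in `y` is expanded in the Bernstein
basis of the interval, where all its coefficients are positive. -/
theorem discriminant_neg_near {y : ℝ} (h0 : 0 < y) (h1 : y ≤ 1 / 2) :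
    defectLin y ^ 2 < 4 * (1 + (12 / 5 - 56 / 75) * y ^ 2) * (defectConst y - 24 / 5 * y ^ 4) := by
  have ht : 0 ≤ y := by linarith
  have hr : 0 ≤ 1 / 2 - y := by linarith
  have hpos : 0 < y ∨ 0 < 1 / 2 - y := by
    by_contra! h
    linarith
  have key : ∀ t r : ℝ, 0 ≤ t → 0 ≤ r → 0 < t ∨ 0 < r → 0 <
      1703116800 * r ^ 8 + 13685145600 * t * r ^ 7 +
      47150028800 * t ^ 2 * r ^ 6 + 90116908032 * t ^ 3 * r ^ 5 +
      103387970304 * t ^ 4 * r ^ 4 + 71732423232 * t ^ 5 * r ^ 3 +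
      28490749056 * t ^ 6 * r ^ 2 + 5480799768 * t ^ 7 * r + 283405743 * t ^ 8 := by
    rintro t r ht hr (h | h) <;> positivity
  simp only [defectConst, defectLin]
  linarith [mul_pos (pow_pos h0 4) (key _ _ ht hr hpos)]

theorem discriminant_neg_middle {y : ℝ} (h0 : 1 / 2 ≤ y) (h1 : y ≤ 1) :
    defectLin y ^ 2 < 4 * (1 + 567 / 500 - 56 / 75 * y ^ 2) * (defectConst y - 45927 / 100000) := by
  have ht : 0 ≤ y - 1 / 2 := by linarith
  have hr : 0 ≤ 1 - y := by linarith
  have hpos : 0 < y - 1 / 2 ∨ 0 < 1 - y := by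
    by_contra! h
    linarith
  have key : ∀ t r : ℝ, 0 ≤ t → 0 ≤ r → 0 < t ∨ 0 < r → 0 <
      1225527767343 * r ^ 12 + 29868701237136 * t * r ^ 11 +
      247247524423368 * t ^ 2 * r ^ 10 + 1090911336284160 * t ^ 3 * r ^ 9 +
      3012364553996160 * t ^ 4 * r ^ 8 + 5610633430419456 * t ^ 5 * r ^ 7 +
      7309706089974272 * t ^ 6 * r ^ 6 + 6750040745404416 * t ^ 7 * r ^ 5 +
      4394166617967360 * t ^ 8 * r ^ 4 + 1965061625384960 * t ^ 9 * r ^ 3 +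
      570658042226688 * t ^ 10 * r ^ 2 + 95736793767936 * t ^ 11 * r +
      6884272437248 * t ^ 12 := by
    rintro t r ht hr (h | h) <;> positivity
  simp only [defectConst, defectLin]
  linarith [key _ _ ht hr hpos]

theorem discriminant_neg_far {y : ℝ} (h0 : 1 ≤ y) (h1 : y ≤ 2) :
    defectLin y ^ 2 < 4 * (1 + 16 / 7 + 1 - 56 / 75 * y ^ 2) * (defectConst y - 15 / 7) := by
  have ht : 0 ≤ y - 1 := by linarith
  have hr : 0 ≤ 2 - y := by linarith
  have hpos : 0 < y - 1 ∨ 0 < 2 - y := by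
    by_contra! h
    linarith
  have key : ∀ t r : ℝ, 0 ≤ t → 0 ≤ r → 0 < t ∨ 0 < r → 0 <
      503256143 * r ^ 12 + 8668609044 * t * r ^ 11 +
      61180928880 * t ^ 2 * r ^ 10 + 244302826328 * t ^ 3 * r ^ 9 +
      627075260340 * t ^ 4 * r ^ 8 + 1100884535616 * t ^ 5 * r ^ 7 +
      1360869963488 * t ^ 6 * r ^ 6 + 1192186697280 * t ^ 7 * r ^ 5 +
      729427980096 * t ^ 8 * r ^ 4 + 299134598400 * t ^ 9 * r ^ 3 +
      75425126400 * t ^ 10 * r ^ 2 + 9623232000 * t ^ 11 * r +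
      317692800 * t ^ 12 := by
    rintro t r ht hr (h | h) <;> positivity
  simp only [defectConst, defectLin]
  linarith [key _ _ ht hr hpos]

/-- The part of `defectPoly` that controls it from below: a quadratic in `s`, up to a multiple of
`s⁴`, without which its discriminant would not keep its sign near `y = 0`. -/
theorem defect_core_pos {s y : ℝ} (hs : s ^ 2 ≤ 1) (h0 : 0 < y) (h2 : y ≤ 2) :
    0 < (1 - 56 / 75 * y ^ 2) * s ^ 2 + defectLin y * s + defectConst y + 343 / 300 * s ^ 4 := by
  rcases le_total y (1 / 2) with h | h
  · have := quadratic_pos_of_sq_lt (A := 1 + (12 / 5 - 56 / 75) * y ^ 2) (by positivity)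
      (discriminant_neg_near h0 h) s
    -- `s⁴` lies above its tangent in `s²` at `s² = (2y)²`, where the valley `η + ζ² = 0` runs
    nlinarith [sq_nonneg (s ^ 2 - 4 * y ^ 2), sq_nonneg (s ^ 2)]
  rcases le_total y 1 with h' | h'
  · have := quadratic_pos_of_sq_lt (A := 1 + 567 / 500 - 56 / 75 * y ^ 2) (by nlinarith)
      (discriminant_neg_middle h h') s
    -- tangent at `s² = 81/100`
    nlinarith [sq_nonneg (s ^ 2 - 81 / 100), sq_nonneg (s ^ 2)]
  · have := quadratic_pos_of_sq_lt (A := 1 + 16 / 7 + 1 - 56 / 75 * y ^ 2) (by nlinarith)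
      (discriminant_neg_far h' h2) s
    -- tangent at `s² = 1`, and a further multiple of `1 - s²`
    nlinarith [sq_nonneg (s ^ 2 - 1), sq_nonneg (s ^ 2)]

/-- With `s = sin η`, `q = 1 - cos η` and `y = 1 - cos ζ`, this says that `φ̂ < 1` away from the
origin. -/
theorem defectPoly_pos {q s y : ℝ} (hs : s ^ 2 = q * (2 - q)) (hq0 : 0 ≤ q)
    (hy0 : 0 ≤ y) (hy2 : y ≤ 2) (h : q ≠ 0 ∨ y ≠ 0) : 0 < defectPoly q s y := by
  have hs1 : s ^ 2 ≤ 1 := by nlinarith [sq_nonneg (q - 1)]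
  have hs4 : s ^ 4 = (q * (2 - q)) ^ 2 := by rw [← hs]; ring
  -- The terms in `q` alone exceed `s² + 13/10 s⁴`. The term `47/75 (1 - y/2) s³ y` is absorbed by
  -- completing the square in `s²/2 + s y`, at the price of `47/300 s⁴ + 47/75 s² y²`.
  have e : defectPoly q s y =
      q ^ 2 * (17 / 150 + 341 / 300 * q + 17 / 600 * q ^ 2) +
      ((1 - 56 / 75 * y ^ 2) * s ^ 2 + defectLin y * s + defectConst y + 343 / 300 * s ^ 4) +
      47 / 75 * ((y / 2) * (s ^ 4 / 4 + s ^ 2 * y ^ 2) +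
        (1 - y / 2) * (s ^ 2 / 2 + s * y) ^ 2) +
      s ^ 2 * (y ^ 3 * (3 / 25 - 3 / 100 * y)) := by
    simp only [defectPoly, defectLin, defectConst]
    linear_combination (-1 : ℝ) * hs - 13 / 10 * hs4
  have h1 : 0 ≤ q ^ 2 * (17 / 150 + 341 / 300 * q + 17 / 600 * q ^ 2) := by positivity
  have h3 : 0 ≤ (1 - y / 2) * (s ^ 2 / 2 + s * y) ^ 2 :=
    mul_nonneg (by linarith) (sq_nonneg _)
  have h4 : 0 ≤ y / 2 * (s ^ 4 / 4 + s ^ 2 * y ^ 2) := by positivity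
  have h5 : 0 ≤ s ^ 2 * (y ^ 3 * (3 / 25 - 3 / 100 * y)) :=
    mul_nonneg (sq_nonneg _) (mul_nonneg (by positivity) (by linarith))
  rw [e]
  rcases hy0.eq_or_lt with rfl | hy
  · have hq : 0 < q := hq0.lt_of_ne (by tauto)
    have h1' : 0 < q ^ 2 * (17 / 150 + 341 / 300 * q + 17 / 600 * q ^ 2) := by positivity
    have h2 : 0 ≤ (1 - 56 / 75 * (0 : ℝ) ^ 2) * s ^ 2 + defectLin 0 * s + defectConst 0 +
        343 / 300 * s ^ 4 := by
      simp only [defectLin, defectConst]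
      norm_num
      positivity
    linarith
  · linarith [defect_core_pos hs1 hy hy2]

/-- With `s = sin η`, `q = 1 - cos η` and `y = 1 - cos ζ`, this says that `φ̂ > 0`; the powers of
`y` are bounded one by one, except for the terms of degree at least five free of `s`. -/
theorem defectPoly_lt {q s y : ℝ} (hs : s ^ 2 = q * (2 - q)) (hq0 : 0 ≤ q) (hq2 : q ≤ 2)
    (hy0 : 0 ≤ y) (hy2 : y ≤ 2) : defectPoly q s y < 100 := by
  have hs1 : s ^ 2 ≤ 1 := by nlinarith [sq_nonneg (q - 1)]
  have hs4 : s ^ 4 = (q * (2 - q)) ^ 2 := by rw [← hs]; ring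
  have hs4' : s ^ 4 ≤ 1 := by nlinarith [sq_nonneg s]
  obtain ⟨hl, hu⟩ := abs_le.1 ((sq_le_one_iff_abs_le_one s).1 hs1)
  have hl3 : -1 ≤ s ^ 3 := by nlinarith
  have hu3 : s ^ 3 ≤ 1 := by nlinarith
  have hb : ∀ (i : ℕ) (a b : ℝ), a ≤ b → 0 ≤ b → y ^ i * a ≤ 2 ^ i * b := fun i a b hab hb =>
    (mul_le_mul_of_nonneg_left hab (by positivity)).trans
      (mul_le_mul_of_nonneg_right (pow_le_pow_left₀ hy0 hy2 i) hb)
  have h0 : q ^ 2 * (17 / 150 + 341 / 300 * q + 17 / 600 * q ^ 2) ≤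
      2 ^ 2 * (17 / 150 + 341 / 300 * 2 + 17 / 600 * 2 ^ 2) := by gcongr
  have h1 := hb 1 (4 * s + 47 / 75 * s ^ 3) (4 + 47 / 75) (by linarith) (by norm_num)
  have h2 := hb 2 (4 + 2 / 3 * s - 3 / 25 * s ^ 2 - 47 / 150 * s ^ 3) 5
    (by linarith [sq_nonneg s]) (by norm_num)
  have h3 := hb 3 (4 / 3 + 4 / 225 * s + 3 / 25 * s ^ 2) (3 / 2) (by linarith) (by norm_num)
  have h4 := hb 4 (29 / 75 - 43 / 50 * s - 3 / 100 * s ^ 2) (5 / 4) (by linarith [sq_nonneg s])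
    (by norm_num)
  have h5 := hb 5 (77 / 150 * s) (77 / 150) (by linarith) (by norm_num)
  have h6 := hb 6 (-77 / 900 * s) (77 / 900) (by linarith) (by norm_num)
  have h7 : 0 ≤ y ^ 5 * (283 / 75 - 256 / 75 * y + 179 / 150 * y ^ 2 - 179 / 1200 * y ^ 3) :=
    mul_nonneg (by positivity)
      (by nlinarith [mul_nonneg (sq_nonneg y) (sub_nonneg.2 hy2), sq_nonneg (y - 2)])
  simp only [defectPoly]
  linarith

/-! ### Expansion of the symbol at the origin -/

/-- The anisotropic size `|η| + ζ²`, in which `symbolP` is of order two with a degenerate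
direction. -/
def anisoSize (ξ : ℝ × ℝ) : ℝ := |ξ.1| + ξ.2 ^ 2

/-- `f` vanishes to order `n` at the origin, measured by `anisoSize`. -/
def AnisoOrder (n : ℕ) (f : ℝ × ℝ → ℝ) : Prop :=
  f =O[𝓝 0] fun ξ => anisoSize ξ ^ n

theorem anisoSize_nonneg (ξ : ℝ × ℝ) : 0 ≤ anisoSize ξ := by
  unfold anisoSize
  positivity

theorem continuous_anisoSize : Continuous anisoSize := by
  unfold anisoSize
  fun_prop

theorem tendsto_anisoSize : Tendsto anisoSize (𝓝 0) (𝓝 0) := by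
  simpa [anisoSize] using continuous_anisoSize.tendsto 0

namespace AnisoOrder

variable {m n : ℕ} {f g : ℝ × ℝ → ℝ}

theorem add (hf : AnisoOrder n f) (hg : AnisoOrder n g) : AnisoOrder n fun ξ => f ξ + g ξ :=
  Asymptotics.IsBigO.add hf hg

theorem sub (hf : AnisoOrder n f) (hg : AnisoOrder n g) : AnisoOrder n fun ξ => f ξ - g ξ :=
  Asymptotics.IsBigO.sub hf hg

theorem mul (hf : AnisoOrder m f) (hg : AnisoOrder n g) :
    AnisoOrder (m + n) fun ξ => f ξ * g ξ := by
  simpa only [AnisoOrder, pow_add] using Asymptotics.IsBigO.mul hf hg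

theorem pow (hf : AnisoOrder n f) (k : ℕ) : AnisoOrder (n * k) fun ξ => f ξ ^ k := by
  simpa only [AnisoOrder, pow_mul] using Asymptotics.IsBigO.pow hf k

theorem const_mul (c : ℝ) (hf : AnisoOrder n f) : AnisoOrder n fun ξ => c * f ξ :=
  Asymptotics.IsBigO.const_mul_left hf c

theorem of_bound (C : ℝ) (h : ∀ᶠ ξ in 𝓝 (0 : ℝ × ℝ), |f ξ| ≤ C * anisoSize ξ ^ n) :
    AnisoOrder n f := by
  refine Asymptotics.IsBigO.of_bound C (h.mono fun ξ hξ => ?_)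
  rwa [Real.norm_eq_abs, Real.norm_of_nonneg (pow_nonneg (anisoSize_nonneg ξ) n)]

theorem of_continuous (hf : Continuous f) : AnisoOrder 0 f := by
  simpa only [AnisoOrder, pow_zero] using (hf.tendsto 0).isBigO_one ℝ

theorem mono (h : m ≤ n) (hf : AnisoOrder n f) : AnisoOrder m f := by
  refine Asymptotics.IsBigO.trans hf (Asymptotics.IsBigO.of_bound 1 ?_)
  filter_upwards [tendsto_anisoSize.eventually (gt_mem_nhds one_pos)] with ξ hξ
  have h0 := anisoSize_nonneg ξ
  rw [Real.norm_of_nonneg (pow_nonneg h0 n), Real.norm_of_nonneg (pow_nonneg h0 m), one_mul]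
  exact pow_le_pow_of_le_one h0 hξ.le h

/-- A continuous factor does not lower the order. -/
theorem mul_continuous (hf : AnisoOrder n f) (hg : Continuous g) :
    AnisoOrder n fun ξ => f ξ * g ξ :=
  hf.mul (of_continuous hg)

end AnisoOrder

theorem anisoOrder_fst : AnisoOrder 1 fun ξ => ξ.1 :=
  .of_bound 1 <| Eventually.of_forall fun ξ => by
    rw [anisoSize, pow_one, one_mul]
    exact le_add_of_nonneg_right (sq_nonneg _)

theorem anisoOrder_snd_sq : AnisoOrder 1 fun ξ => ξ.2 ^ 2 :=
  .of_bound 1 <| Eventually.of_forall fun ξ => by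
    rw [anisoSize, pow_one, one_mul, abs_of_nonneg (sq_nonneg _)]
    exact le_add_of_nonneg_left (abs_nonneg _)

theorem cos_taylor_bound {x : ℝ} (hx : |x| ≤ 1) :
    |Real.cos x - (1 - x ^ 2 / 2 + x ^ 4 / 24 - x ^ 6 / 720)| ≤ x ^ 8 := by
  have hn : ‖(x * Complex.I : ℂ)‖ = |x| := by simp
  have h := Complex.exp_bound (x := x * Complex.I) (by rw [hn]; exact hx) (n := 8) (by norm_num)
  have hre := (Complex.abs_re_le_norm _).trans h
  rw [hn] at hre
  have e : (Complex.exp (x * Complex.I) -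
      ∑ m ∈ Finset.range 8, (x * Complex.I : ℂ) ^ m / m.factorial).re =
      Real.cos x - (1 - x ^ 2 / 2 + x ^ 4 / 24 - x ^ 6 / 720) := by
    have e1 : ∑ m ∈ Finset.range 8, (x * Complex.I : ℂ) ^ m / m.factorial =
        ((1 - x ^ 2 / 2 + x ^ 4 / 24 - x ^ 6 / 720 : ℝ) : ℂ) +
        ((x - x ^ 3 / 6 + x ^ 5 / 120 - x ^ 7 / 5040 : ℝ) : ℂ) * Complex.I := by
      simp only [Finset.sum_range_succ, Finset.sum_range_zero, Nat.factorial]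
      push_cast
      have h2 := Complex.I_sq
      generalize Complex.I = i at *
      linear_combination (x ^ 2 / 2 + x ^ 3 / 6 * i + x ^ 4 / 24 * (i ^ 2 - 1) +
        x ^ 5 / 120 * i * (i ^ 2 - 1) + x ^ 6 / 720 * (i ^ 4 - i ^ 2 + 1) +
        x ^ 7 / 5040 * i * (i ^ 4 - i ^ 2 + 1) : ℂ) * h2
    rw [e1, Complex.sub_re, Complex.exp_ofReal_mul_I_re, Complex.add_re, Complex.ofReal_re,
      Complex.re_ofReal_mul, Complex.I_re]
    ring
  rw [e] at hre
  refine hre.trans ?_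
  have h8 : |x| ^ 8 = x ^ 8 := by rw [← abs_pow, abs_of_nonneg (by positivity)]
  rw [h8]
  have : 0 ≤ x ^ 8 := by positivity
  norm_num [Nat.factorial]
  linarith

theorem eventually_abs_le_one :
    ∀ᶠ ξ : ℝ × ℝ in 𝓝 0, |ξ.1| ≤ 1 ∧ |ξ.2| ≤ 1 := by
  have h1 : Tendsto (fun ξ : ℝ × ℝ => |ξ.1|) (𝓝 0) (𝓝 0) := by
    simpa using (continuous_fst.abs : Continuous fun ξ : ℝ × ℝ => |ξ.1|).tendsto 0
  have h2 : Tendsto (fun ξ : ℝ × ℝ => |ξ.2|) (𝓝 0) (𝓝 0) := by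
    simpa using (continuous_snd.abs : Continuous fun ξ : ℝ × ℝ => |ξ.2|).tendsto 0
  filter_upwards [h1.eventually (gt_mem_nhds one_pos), h2.eventually (gt_mem_nhds one_pos)]
    with ξ a b using ⟨a.le, b.le⟩

theorem anisoOrder_sin : AnisoOrder 1 fun ξ => Real.sin ξ.1 :=
  .of_bound 1 <| Eventually.of_forall fun ξ => by
    rw [anisoSize, pow_one, one_mul]
    exact Real.abs_sin_le_abs.trans (le_add_of_nonneg_right (sq_nonneg _))

theorem anisoOrder_one_sub_cos_fst : AnisoOrder 2 fun ξ => 1 - Real.cos ξ.1 := by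
  refine .of_bound 1 <| Eventually.of_forall fun ξ => ?_
  rw [abs_of_nonneg (by linarith [Real.cos_le_one ξ.1]), anisoSize]
  have := Real.one_sub_sq_div_two_le_cos (x := ξ.1)
  nlinarith [sq_abs ξ.1, abs_nonneg ξ.1, sq_nonneg ξ.2, sq_nonneg (ξ.2 ^ 2),
    mul_nonneg (abs_nonneg ξ.1) (sq_nonneg ξ.2)]

theorem anisoOrder_one_sub_cos_snd : AnisoOrder 1 fun ξ => 1 - Real.cos ξ.2 := by
  refine .of_bound 1 <| Eventually.of_forall fun ξ => ?_
  rw [abs_of_nonneg (by linarith [Real.cos_le_one ξ.2]), anisoSize]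
  have := Real.one_sub_sq_div_two_le_cos (x := ξ.2)
  nlinarith [abs_nonneg ξ.1, sq_nonneg ξ.2]

/-- `η = s + s³/6` up to order four, where `s = sin η`. -/
theorem anisoOrder_fst_sub : AnisoOrder 4 fun ξ => ξ.1 - Real.sin ξ.1 - Real.sin ξ.1 ^ 3 / 6 := by
  have h : AnisoOrder 4 fun ξ => Real.sin ξ.1 - (ξ.1 - ξ.1 ^ 3 / 6) := by
    refine .of_bound 1 ?_
    filter_upwards [eventually_abs_le_one] with ξ hξ
    have h0 := abs_nonneg ξ.1
    calc |Real.sin ξ.1 - (ξ.1 - ξ.1 ^ 3 / 6)| ≤ |ξ.1| ^ 5 / 100 := Real.sin_bound hξ.1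
      _ ≤ |ξ.1| ^ 4 := by
        have := pow_le_pow_of_le_one h0 hξ.1 (show 4 ≤ 5 by norm_num)
        linarith [pow_nonneg h0 5]
      _ ≤ 1 * anisoSize ξ ^ 4 := by
        rw [one_mul, anisoSize]
        exact pow_le_pow_left₀ h0 (le_add_of_nonneg_right (sq_nonneg _)) 4
  have h3 : AnisoOrder 3 fun ξ => ξ.1 - Real.sin ξ.1 := by
    have := ((anisoOrder_fst.pow 3).const_mul (1 / 6)).sub (h.mono (show 1 * 3 ≤ 4 by norm_num))
    convert this using 2
    ring
  have h5 := (h3.mul anisoOrder_fst).mul_continuous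
    (g := fun ξ => (1 / 6) * (ξ.1 + Real.sin ξ.1)) (by fun_prop)
  have h5' := (h3.mul anisoOrder_sin).mul_continuous
    (g := fun ξ => (1 / 6) * Real.sin ξ.1) (by fun_prop)
  have := (h5.add h5').sub h
  convert this using 2
  ring

/-- `ζ² = 2y + y²/3 + 4y³/45` up to order four, where `y = 1 - cos ζ`. -/
theorem anisoOrder_snd_sq_sub : AnisoOrder 4 fun ξ => ξ.2 ^ 2 - 2 * (1 - Real.cos ξ.2) -
    (1 - Real.cos ξ.2) ^ 2 / 3 - 4 / 45 * (1 - Real.cos ξ.2) ^ 3 := by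
  have h : AnisoOrder 4 fun ξ =>
      Real.cos ξ.2 - (1 - ξ.2 ^ 2 / 2 + ξ.2 ^ 4 / 24 - ξ.2 ^ 6 / 720) := by
    refine .of_bound 1 ?_
    filter_upwards [eventually_abs_le_one] with ξ hξ
    refine (cos_taylor_bound hξ.2).trans ?_
    rw [one_mul, anisoSize, show ξ.2 ^ 8 = (ξ.2 ^ 2) ^ 4 by ring]
    exact pow_le_pow_left₀ (sq_nonneg _) (le_add_of_nonneg_left (abs_nonneg _)) 4
  have hw := (anisoOrder_snd_sq.pow 4).mul_continuous (g := fun ξ =>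
    1 / 576 - 37 / 129600 * ξ.2 ^ 2 + 11 / 518400 * ξ.2 ^ 4 - 7 / 7776000 * ξ.2 ^ 6 +
      1 / 46656000 * ξ.2 ^ 8 - 1 / 4199040000 * ξ.2 ^ 10) (by fun_prop)
  have hr := h.mul_continuous (g := fun ξ => 2 +
    ((1 - Real.cos ξ.2) + (ξ.2 ^ 2 / 2 - ξ.2 ^ 4 / 24 + ξ.2 ^ 6 / 720)) / 3 +
    4 / 45 * ((1 - Real.cos ξ.2) ^ 2 +
      (1 - Real.cos ξ.2) * (ξ.2 ^ 2 / 2 - ξ.2 ^ 4 / 24 + ξ.2 ^ 6 / 720) +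
      (ξ.2 ^ 2 / 2 - ξ.2 ^ 4 / 24 + ξ.2 ^ 6 / 720) ^ 2)) (by fun_prop)
  convert hw.add hr using 2
  ring

/-- Near the origin `100 (1 - φ̂)` agrees with `P - (η + ζ²)⁴ / 200` up to order five. -/
theorem anisoOrder_defect_sub :
    AnisoOrder 5 fun ξ => defect ξ - symbolP ξ + (ξ.1 + ξ.2 ^ 2) ^ 4 / 200 := by
  have hs := anisoOrder_sin
  have hq := anisoOrder_one_sub_cos_fst
  have hy := anisoOrder_one_sub_cos_snd
  have he := anisoOrder_fst_sub
  have hv := anisoOrder_snd_sq_sub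
  have hη := anisoOrder_fst
  have hw := anisoOrder_snd_sq
  -- terms of `defectPoly` of order at least five
  have t1 : AnisoOrder 5 fun ξ => (5 / 4) * (1 - Real.cos ξ.1) ^ 3 :=
    ((hq.pow 3).const_mul _).mono (by norm_num)
  have t2 := (((hy.pow 2).mul (hs.pow 2)).mul hs).mul_continuous
    (g := fun _ => -47 / 150) (by fun_prop)
  have t3 := (((hy.pow 2).mul (hs.pow 2)).mul hy).mul_continuous
    (g := fun ξ => 3 / 25 - 3 / 100 * (1 - Real.cos ξ.2)) (by fun_prop)
  have t4 := ((hy.pow 4).mul hs).mul_continuous (g := fun _ => -43 / 50) (by fun_prop)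
  have t5 := (hy.pow 5).mul_continuous (g := fun ξ =>
    (-283 / 75 + 77 / 150 * Real.sin ξ.1) +
      (1 - Real.cos ξ.2) * (256 / 75 - 77 / 900 * Real.sin ξ.1) -
      179 / 150 * (1 - Real.cos ξ.2) ^ 2 + 179 / 1200 * (1 - Real.cos ξ.2) ^ 3) (by fun_prop)
  -- terms of order at least five in the square of `s + s³/6 + 2y + y²/3 + 4y³/45`
  have hc : AnisoOrder 3 fun ξ => Real.sin ξ.1 ^ 3 / 6 + 4 / 45 * (1 - Real.cos ξ.2) ^ 3 := by
    convert ((hs.pow 3).const_mul (1 / 6)).add ((hy.pow 3).const_mul (4 / 45)) using 2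
    ring
  have t6 := ((hy.pow 2).mul hc).const_mul (2 / 3)
  have t7 : AnisoOrder 5 fun ξ =>
      (Real.sin ξ.1 ^ 3 / 6 + 4 / 45 * (1 - Real.cos ξ.2) ^ 3) ^ 2 := (hc.pow 2).mono (by norm_num)
  -- replacing `η` and `ζ²` by their expansions in `s` and `y`
  have hd := he.add hv
  have hsum := (((hη.add hw).add hs).add (hy.const_mul 2)).add
    (((hs.pow 3).const_mul (1 / 6)).mono (show 1 ≤ 1 * 3 by norm_num))
  have hsum' := (hsum.add (((hy.pow 2).const_mul (1 / 3)).mono (show 1 ≤ 1 * 2 by norm_num))).add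
    (((hy.pow 3).const_mul (4 / 45)).mono (show 1 ≤ 1 * 3 by norm_num))
  have t8 := hd.mul hsum'
  have hηs : AnisoOrder 3 fun ξ => ξ.1 - Real.sin ξ.1 := by
    convert (he.mono (show 3 ≤ 4 by norm_num)).add ((hs.pow 3).const_mul (1 / 6)) using 2
    ring
  have hη3 := ((hη.pow 2).add (hs.pow 2)).mul (hη.add hs)
  have t9 : AnisoOrder 5 fun ξ => (ξ.1 - Real.sin ξ.1) *
      ((ξ.1 ^ 2 + Real.sin ξ.1 ^ 2) * (ξ.1 + Real.sin ξ.1)) := (hηs.mul hη3).mono (by norm_num)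
  have hd2 : AnisoOrder 2 fun ξ => ξ.1 + ξ.2 ^ 2 - (Real.sin ξ.1 + 2 * (1 - Real.cos ξ.2)) := by
    convert ((hd.mono (show 2 ≤ 4 by norm_num)).add ((hy.pow 2).const_mul (1 / 3))).add
      (hc.mono (show 2 ≤ 3 by norm_num)) using 2
    ring
  have hu := hη.add hw
  have hu' := hs.add (hy.const_mul 2)
  have t10 := (hd2.mul (((hu.pow 2).add (hu'.pow 2)).mul (hu.add hu'))).const_mul (1 / 200)
  have hfin := (((((((t1.add t2).add t3).add t4).add t5).sub (t6.add t7)).sub t8).sub t9).add t10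
  refine Asymptotics.IsBigO.congr_left hfin fun ξ => ?_
  have e := Real.sin_sq_add_cos_sq ξ.1
  simp only [defect, defectPoly, symbolP]
  generalize Real.sin ξ.1 = s at *
  obtain ⟨q, hq⟩ : ∃ q, q = 1 - Real.cos ξ.1 := ⟨_, rfl⟩
  have e1 : s ^ 2 = q * (2 - q) := by rw [hq]; linear_combination e
  have e2 : s ^ 4 = (q * (2 - q)) ^ 2 := by rw [← e1]; ring
  rw [← hq]
  linear_combination e1 + 797 / 600 * e2

/-! ### Comparison of the symbol with `P` on the fundamental cell -/

theorem continuous_symbolP : Continuous symbolP := by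
  unfold symbolP
  fun_prop

theorem continuous_defect : Continuous defect := by
  unfold defect defectPoly
  fun_prop

theorem symbolP_nonneg (ξ : ℝ × ℝ) : 0 ≤ symbolP ξ := by
  unfold symbolP
  positivity

theorem symbolP_pos {ξ : ℝ × ℝ} (h : ξ ≠ 0) : 0 < symbolP ξ := by
  refine (symbolP_nonneg ξ).lt_of_ne' fun h0 => h ?_
  obtain ⟨η, ζ⟩ := ξ
  simp only [symbolP] at h0
  have h1 : η ^ 4 = 0 := by nlinarith [sq_nonneg (η + ζ ^ 2), sq_nonneg (η ^ 2)]
  have hη : η = 0 := by simpa using h1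
  subst hη
  have h2 : ζ = 0 := by simpa using h0
  rw [h2]
  rfl

theorem anisoSize_pow_four_le {ξ : ℝ × ℝ} (h : anisoSize ξ ≤ 1) :
    anisoSize ξ ^ 4 ≤ 81 * symbolP ξ := by
  obtain ⟨η, ζ⟩ := ξ
  have h0 := anisoSize_nonneg (η, ζ)
  simp only [anisoSize, symbolP] at *
  have hη : η ^ 4 = |η| ^ 4 := (Even.pow_abs (by decide) η).symm
  rcases le_total (ζ ^ 2) (2 * |η|) with hc | hc
  · calc (|η| + ζ ^ 2) ^ 4 ≤ (3 * |η|) ^ 4 := pow_le_pow_left₀ h0 (by linarith) 4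
      _ ≤ _ := by
        rw [hη]
        nlinarith [sq_nonneg (η + ζ ^ 2)]
  · have hu : |η| + ζ ^ 2 ≤ 3 * (η + ζ ^ 2) := by linarith [neg_abs_le η]
    have hsq : (|η| + ζ ^ 2) ^ 2 ≤ 9 * (η + ζ ^ 2) ^ 2 := by nlinarith
    have h4 : 0 ≤ η ^ 4 := by positivity
    have : (|η| + ζ ^ 2) ^ 4 ≤ (|η| + ζ ^ 2) ^ 2 := pow_le_pow_of_le_one h0 h (by norm_num)
    nlinarith [sq_nonneg (η + ζ ^ 2)]

theorem eventually_half_symbolP_le_defect : ∀ᶠ ξ in 𝓝 0, 1 / 2 * symbolP ξ ≤ defect ξ := by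
  obtain ⟨C, hC, h⟩ := Asymptotics.IsBigO.exists_pos anisoOrder_defect_sub
  have hu : Tendsto (fun ξ : ℝ × ℝ => (ξ.1 + ξ.2 ^ 2) ^ 2) (𝓝 0) (𝓝 0) := by
    have : Continuous fun ξ : ℝ × ℝ => (ξ.1 + ξ.2 ^ 2) ^ 2 := by fun_prop
    simpa using this.tendsto 0
  filter_upwards [h.bound, hu.eventually (gt_mem_nhds one_pos),
    tendsto_anisoSize.eventually (gt_mem_nhds one_pos),
    tendsto_anisoSize.eventually (gt_mem_nhds (show 0 < 1 / (324 * C) by positivity))]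
    with ξ hb h1 h2 h3
  have h0 := anisoSize_nonneg ξ
  have hP := anisoSize_pow_four_le h2.le
  rw [Real.norm_eq_abs, Real.norm_of_nonneg (pow_nonneg h0 5)] at hb
  have hlow := (abs_le.1 hb).1
  have h5 : C * anisoSize ξ ^ 5 ≤ 1 / 4 * symbolP ξ := by
    have : C * anisoSize ξ ≤ 1 / 324 := by
      rw [lt_div_iff₀ (by positivity)] at h3
      linarith
    calc C * anisoSize ξ ^ 5 = C * anisoSize ξ * anisoSize ξ ^ 4 := by ring
      _ ≤ 1 / 324 * (81 * symbolP ξ) := by gcongr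
      _ = _ := by ring
  have h4 : (ξ.1 + ξ.2 ^ 2) ^ 4 ≤ symbolP ξ := by
    simp only [symbolP]
    nlinarith [sq_nonneg (ξ.1 + ξ.2 ^ 2), sq_nonneg (ξ.1 ^ 2)]
  have := symbolP_nonneg ξ
  linarith

theorem defect_pos {ξ : ℝ × ℝ} (h1 : |ξ.1| ≤ Real.pi) (h2 : |ξ.2| ≤ Real.pi) (h : ξ ≠ 0) :
    0 < defect ξ := by
  have hpi := Real.pi_pos
  have hcos : ∀ x : ℝ, |x| ≤ Real.pi → 1 - Real.cos x = 0 → x = 0 := fun x hx h0 => by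
    obtain ⟨hl, hr⟩ := abs_le.1 hx
    exact (Real.cos_eq_one_iff_of_lt_of_lt (by linarith) (by linarith)).1 (by linarith)
  refine defectPoly_pos (by linear_combination Real.sin_sq_add_cos_sq ξ.1)
    (by linarith [Real.cos_le_one ξ.1]) (by linarith [Real.cos_le_one ξ.2])
    (by linarith [Real.neg_one_le_cos ξ.2]) ?_
  by_contra! h0
  exact h (Prod.ext (hcos _ h1 h0.1) (hcos _ h2 h0.2))

theorem defect_lt (ξ : ℝ × ℝ) : defect ξ < 100 :=
  defectPoly_lt (by linear_combination Real.sin_sq_add_cos_sq ξ.1)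
    (by linarith [Real.cos_le_one ξ.1]) (by linarith [Real.neg_one_le_cos ξ.1])
    (by linarith [Real.cos_le_one ξ.2]) (by linarith [Real.neg_one_le_cos ξ.2])

/-- On the fundamental cell `1 - φ̂` is bounded below by a multiple of `P`. -/
theorem exists_mul_symbolP_le_defect :
    ∃ c : ℝ, 0 < c ∧ c ≤ 1 ∧ ∀ ξ ∈ torusCell, c * symbolP ξ ≤ defect ξ := by
  obtain ⟨U, hU, hUo, h0U⟩ := eventually_nhds_iff.1 eventually_half_symbolP_le_defect
  set K : Set (ℝ × ℝ) := Set.Icc (-Real.pi) Real.pi ×ˢ Set.Icc (-Real.pi) Real.pi with hK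
  have hcomp : IsCompact (K \ U) := (isCompact_Icc.prod isCompact_Icc).diff hUo
  have hne : ∀ ξ ∈ K \ U, ξ ≠ 0 := fun ξ hξ h => hξ.2 (h ▸ h0U)
  obtain ⟨a, ha, hle⟩ := hcomp.exists_forall_le' (f := fun ξ => defect ξ / symbolP ξ)
    (continuous_defect.continuousOn.div continuous_symbolP.continuousOn
      fun ξ hξ => (symbolP_pos (hne ξ hξ)).ne') (a := 0)
    fun ξ hξ => div_pos (defect_pos (abs_le.2 hξ.1.1) (abs_le.2 hξ.1.2) (hne ξ hξ))
      (symbolP_pos (hne ξ hξ))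
  refine ⟨min a (1 / 2), by positivity, (min_le_right _ _).trans (by norm_num), fun ξ hξ => ?_⟩
  have hP := symbolP_nonneg ξ
  by_cases hξU : ξ ∈ U
  · exact (mul_le_mul_of_nonneg_right (min_le_right _ _) hP).trans (hU ξ hξU)
  · have hmem : ξ ∈ K \ U :=
      ⟨Set.prod_mono Set.Ioc_subset_Icc_self Set.Ioc_subset_Icc_self hξ, hξU⟩
    refine (mul_le_mul_of_nonneg_right (min_le_left _ _) hP).trans ?_
    exact (le_div_iff₀ (symbolP_pos (hne ξ hmem))).1 (hle ξ hmem)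

/-! ### Straightening the valley of `P` -/

/-- The change of variables `η + ζ² = b⁴ s`, `ζ = b z` straightening the valley of `symbolP`;
the argument is `(z, s)`. -/
def straighten (b : ℝ) (p : ℝ × ℝ) : ℝ × ℝ := (b ^ 4 * p.2 - (b * p.1) ^ 2, b * p.1)

theorem continuous_straighten (b : ℝ) : Continuous (straighten b) := by
  unfold straighten
  fun_prop

theorem measurableEmbedding_straighten {b : ℝ} (hb : b ≠ 0) :
    MeasurableEmbedding (straighten b) := by
  refine (continuous_straighten b).measurableEmbedding fun p p' h => ?_
  simp only [straighten, Prod.mk.injEq] at h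
  have h1 : p.1 = p'.1 := mul_left_cancel₀ hb h.2
  have h2 : p.2 = p'.2 := by
    have := h.1
    rw [h1] at this
    exact mul_left_cancel₀ (pow_ne_zero 4 hb) (by linarith)
  exact Prod.ext h1 h2

theorem measurePreserving_straighten {b : ℝ} (hb : 0 < b) :
    MeasurePreserving (straighten b) volume (ENNReal.ofReal (b ^ 5)⁻¹ • volume) := by
  have h1 : MeasurePreserving (fun z : ℝ => b * z) volume (ENNReal.ofReal |b⁻¹| • volume) :=
    ⟨by fun_prop, Real.map_volume_mul_left hb.ne'⟩
  have h2 := h1.skew_product (μc := volume) (μd := ENNReal.ofReal |(b ^ 4)⁻¹| • volume)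
    (g := fun z s => b ^ 4 * s - (b * z) ^ 2)
    (by unfold Function.uncurry; fun_prop) (Eventually.of_forall fun z => by
      have : (fun s : ℝ => b ^ 4 * s - (b * z) ^ 2) =
          (fun s => s + -(b * z) ^ 2) ∘ fun s => b ^ 4 * s := by
        funext s
        simp only [Function.comp]
        ring
      rw [this, ← Measure.map_map (by fun_prop) (by fun_prop),
        Real.map_volume_mul_left (pow_ne_zero 4 hb.ne'), Measure.map_smul,
        map_add_right_eq_self])
  have h3 : MeasurePreserving Prod.swap
      ((ENNReal.ofReal |b⁻¹| • (volume : Measure ℝ)).prod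
        (ENNReal.ofReal |(b ^ 4)⁻¹| • (volume : Measure ℝ)))
      ((ENNReal.ofReal |(b ^ 4)⁻¹| • (volume : Measure ℝ)).prod
        (ENNReal.ofReal |b⁻¹| • (volume : Measure ℝ))) := Measure.measurePreserving_swap
  have h4 := h3.comp h2
  rw [Measure.prod_smul_left, Measure.prod_smul_right, smul_smul,
    ← ENNReal.ofReal_mul (abs_nonneg _), ← abs_mul, ← mul_inv, ← pow_succ,
    abs_of_pos (by positivity)] at h4
  exact h4

theorem integral_straighten {E : Type*} [NormedAddCommGroup E] [NormedSpace ℝ E] {b : ℝ}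
    (hb : 0 < b) (f : ℝ × ℝ → E) : ∫ ξ, f ξ = b ^ 5 • ∫ p, f (straighten b p) := by
  rw [(measurePreserving_straighten hb).integral_comp (measurableEmbedding_straighten hb.ne') f,
    integral_smul_measure, ENNReal.toReal_ofReal (by positivity), smul_smul,
    mul_inv_cancel₀ (by positivity), one_smul]

theorem integrable_iff_straighten {E : Type*} [NormedAddCommGroup E] {b : ℝ}
    (hb : 0 < b) (f : ℝ × ℝ → E) :
    Integrable f ↔ Integrable fun p => f (straighten b p) := by
  have h := (measurePreserving_straighten hb).integrable_comp_emb
    (measurableEmbedding_straighten hb.ne') (g := f)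
  rw [show (fun p => f (straighten b p)) = f ∘ straighten b from rfl, h,
    integrable_smul_measure (by positivity) ENNReal.ofReal_ne_top]

theorem symbolP_straighten (b : ℝ) (p : ℝ × ℝ) :
    symbolP (straighten b p) = b ^ 8 * (p.2 ^ 2 + (b ^ 2 * p.2 - p.1 ^ 2) ^ 4) := by
  simp only [symbolP, straighten]
  ring

/-- Quadratic lower bound for the rescaled symbol, uniform in the scale. -/
theorem half_sum_sq_le {b : ℝ} (hb0 : 0 ≤ b) (hb1 : b ≤ 1) (p : ℝ × ℝ) :
    p.1 ^ 2 / 2 + p.2 ^ 2 / 2 - 1 ≤ p.2 ^ 2 + (b ^ 2 * p.2 - p.1 ^ 2) ^ 4 := by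
  obtain ⟨z, s⟩ := p
  have h4 : (b ^ 2) ^ 2 ≤ 1 := by
    rw [← pow_mul]
    exact pow_le_one₀ hb0 hb1
  have h1 : (b ^ 2 * s) ^ 2 ≤ s ^ 2 := by nlinarith [sq_nonneg s]
  have h2 : z ^ 4 / 2 - (b ^ 2 * s) ^ 2 ≤ (b ^ 2 * s - z ^ 2) ^ 2 := by
    nlinarith [sq_nonneg (2 * (b ^ 2 * s) - z ^ 2)]
  have h3 : (b ^ 2 * s - z ^ 2) ^ 2 / 2 - 1 / 16 ≤ (b ^ 2 * s - z ^ 2) ^ 4 := by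
    nlinarith [sq_nonneg ((b ^ 2 * s - z ^ 2) ^ 2 - 1 / 4)]
  have h5 : z ^ 2 / 2 - 1 / 4 ≤ z ^ 4 / 4 := by nlinarith [sq_nonneg (z ^ 2 - 1)]
  simp only
  linarith

/-- The Gaussian dominating the rescaled integrands. -/
noncomputable def gaussianMajorant (c : ℝ) (p : ℝ × ℝ) : ℝ :=
  Real.exp c * (Real.exp (-(c / 2) * p.1 ^ 2) * Real.exp (-(c / 2) * p.2 ^ 2))

theorem integrable_gaussianMajorant {c : ℝ} (hc : 0 < c) : Integrable (gaussianMajorant c) :=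
  (Integrable.mul_prod (integrable_exp_neg_mul_sq (half_pos hc))
    (integrable_exp_neg_mul_sq (half_pos hc))).const_mul _

theorem exp_neg_le_gaussianMajorant {b c : ℝ} (hb0 : 0 ≤ b) (hb1 : b ≤ 1) (hc : 0 ≤ c)
    (p : ℝ × ℝ) :
    Real.exp (-(c * (p.2 ^ 2 + (b ^ 2 * p.2 - p.1 ^ 2) ^ 4))) ≤ gaussianMajorant c p := by
  rw [gaussianMajorant, ← Real.exp_add, ← Real.exp_add]
  apply Real.exp_le_exp.2
  linarith [mul_le_mul_of_nonneg_left (half_sum_sq_le hb0 hb1 p) hc]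

theorem integrable_exp_neg_symbolP {t : ℝ} (ht : 0 < t) :
    Integrable fun ξ : ℝ × ℝ => Real.exp (-(t * symbolP ξ)) := by
  have hcont := continuous_symbolP
  have hst := continuous_straighten 1
  rw [integrable_iff_straighten one_pos]
  refine (integrable_gaussianMajorant ht).mono' (by fun_prop) (Eventually.of_forall fun p => ?_)
  rw [Real.norm_of_nonneg (Real.exp_pos _).le, symbolP_straighten, one_pow, one_mul]
  exact exp_neg_le_gaussianMajorant zero_le_one le_rfl ht.le p

theorem integral_exp_neg_pow_eight :
    ∫ z : ℝ, Real.exp (-z ^ 8) = 2 * Real.Gamma (9 / 8) := by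
  have h := integral_comp_abs (f := fun z : ℝ => Real.exp (-z ^ (8 : ℝ)))
  rw [integral_exp_neg_rpow (by norm_num)] at h
  rw [show (9 / 8 : ℝ) = 1 / 8 + 1 by norm_num, ← h]
  refine integral_congr_ae (Eventually.of_forall fun z => ?_)
  simp only
  rw [show (8 : ℝ) = ((8 : ℕ) : ℝ) by norm_num, Real.rpow_natCast,
    Even.pow_abs (by decide)]

theorem integral_limit_profile :
    ∫ p : ℝ × ℝ, Real.exp (-(p.2 ^ 2 + p.1 ^ 8)) =
      2 * Real.Gamma (9 / 8) * Real.sqrt Real.pi := by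
  have h : ∀ p : ℝ × ℝ, Real.exp (-(p.2 ^ 2 + p.1 ^ 8)) =
      Real.exp (-p.1 ^ 8) * Real.exp (-1 * p.2 ^ 2) := fun p => by
    rw [← Real.exp_add]
    ring_nf
  simp only [h]
  rw [Measure.volume_eq_prod, integral_prod_mul (fun z : ℝ => Real.exp (-z ^ 8))
    (fun s : ℝ => Real.exp (-1 * s ^ 2)), integral_exp_neg_pow_eight, integral_gaussian, div_one]

/-! ### Convergence of the rescaled multipliers -/

/-- The scale `b = (n / 100)^(-1/8)`, for which `n b⁸ = 100`. -/
noncomputable def scale (n : ℕ) : ℝ := ((n : ℝ) / 100) ^ (-(1 / 8) : ℝ)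

theorem scale_pos {n : ℕ} (hn : 1 ≤ n) : 0 < scale n :=
  Real.rpow_pos_of_pos (by positivity) _

theorem scale_le_one {n : ℕ} (hn : 100 ≤ n) : scale n ≤ 1 := by
  refine Real.rpow_le_one_of_one_le_of_nonpos ?_ (by norm_num)
  rw [le_div_iff₀ (by norm_num)]
  exact_mod_cast (by linarith : 1 * 100 ≤ n)

theorem mul_scale_pow_eight {n : ℕ} (hn : 1 ≤ n) : (n : ℝ) / 100 * scale n ^ 8 = 1 := by
  have h : (0 : ℝ) < n / 100 := by positivity
  rw [scale, ← Real.rpow_natCast, ← Real.rpow_mul h.le]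
  norm_num
  rw [Real.rpow_neg_one]
  field_simp

theorem scale_pow_five {n : ℕ} (hn : 1 ≤ n) :
    scale n ^ 5 = (100 : ℝ) ^ (5 / 8 : ℝ) * (n : ℝ) ^ (-(5 / 8) : ℝ) := by
  have h : (0 : ℝ) < n := by positivity
  rw [scale, ← Real.rpow_natCast, ← Real.rpow_mul (by positivity), Real.div_rpow h.le (by norm_num),
    show (-(1 / 8) * (5 : ℕ) : ℝ) = -(5 / 8) by norm_num,
    Real.rpow_neg (show (0 : ℝ) ≤ 100 by norm_num), div_inv_eq_mul, mul_comm]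

theorem tendsto_scale : Tendsto scale atTop (𝓝[>] 0) := by
  refine tendsto_nhdsWithin_iff.2 ⟨?_, ?_⟩
  · exact (tendsto_rpow_neg_atTop (by norm_num)).comp
      (tendsto_natCast_atTop_atTop.atTop_div_const (by norm_num))
  · filter_upwards [eventually_ge_atTop 1] with n hn using scale_pos hn

theorem tendsto_straighten (p : ℝ × ℝ) : Tendsto (fun b => straighten b p) (𝓝[>] 0) (𝓝 0) := by
  have h : Continuous fun b => straighten b p := by
    unfold straighten
    fun_prop
  have := h.tendsto 0
  simp only [straighten, zero_mul, ne_eq, OfNat.ofNat_ne_zero, not_false_eq_true, zero_pow,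
    sub_zero] at this
  exact this.mono_left nhdsWithin_le_nhds

/-- Along the rescaled valley, `100 (1 - φ̂)` converges to the limit profile `s² + z⁸`. -/
theorem tendsto_defect_straighten (p : ℝ × ℝ) :
    Tendsto (fun b => defect (straighten b p) / b ^ 8) (𝓝[>] 0) (𝓝 (p.2 ^ 2 + p.1 ^ 8)) := by
  have h := Asymptotics.IsBigO.comp_tendsto anisoOrder_defect_sub (tendsto_straighten p)
  have hsize : ∀ b, anisoSize (straighten b p) ^ 5 =
      b ^ 10 * (|b ^ 2 * p.2 - p.1 ^ 2| + p.1 ^ 2) ^ 5 := fun b => by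
    have : b ^ 4 * p.2 - (b * p.1) ^ 2 = b ^ 2 * (b ^ 2 * p.2 - p.1 ^ 2) := by ring
    simp only [anisoSize, straighten, this, abs_mul, abs_of_nonneg (sq_nonneg b)]
    ring
  have hcont : Continuous fun b : ℝ => (|b ^ 2 * p.2 - p.1 ^ 2| + p.1 ^ 2) ^ 5 := by fun_prop
  have hbd : (fun b : ℝ => (|b ^ 2 * p.2 - p.1 ^ 2| + p.1 ^ 2) ^ 5) =O[𝓝[>] 0]
      fun _ => (1 : ℝ) := ((hcont.tendsto 0).mono_left nhdsWithin_le_nhds).isBigO_one ℝ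
  have hlit : (fun b : ℝ => b ^ 10) =o[𝓝[>] 0] fun b => b ^ 8 :=
    (Asymptotics.isLittleO_pow_pow (by norm_num)).mono nhdsWithin_le_nhds
  have hsmall := hlit.mul_isBigO hbd
  simp only [mul_one, ← hsize] at hsmall
  have hrem := (h.trans_isLittleO hsmall).tendsto_div_nhds_zero
  have hmain : Tendsto (fun b : ℝ => p.2 ^ 2 + (b ^ 2 * p.2 - p.1 ^ 2) ^ 4 - b ^ 8 * p.2 ^ 4 / 200)
      (𝓝[>] 0) (𝓝 (p.2 ^ 2 + p.1 ^ 8)) := by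
    have hc : Continuous fun b : ℝ =>
        p.2 ^ 2 + (b ^ 2 * p.2 - p.1 ^ 2) ^ 4 - b ^ 8 * p.2 ^ 4 / 200 := by fun_prop
    have := (hc.tendsto 0).mono_left (nhdsWithin_le_nhds (s := Set.Ioi 0))
    convert this using 2
    ring
  have hsum := hrem.add hmain
  rw [zero_add] at hsum
  refine hsum.congr' ?_
  filter_upwards [self_mem_nhdsWithin] with b hb
  have hb0 : b ≠ 0 := ne_of_gt hb
  simp only [Function.comp, symbolP_straighten]
  simp only [straighten]
  field_simp
  ring

/-- The Fourier multiplier `φ̂ⁿ` on the fundamental cell, extended by zero. -/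
noncomputable def cellMultiplier (n : ℕ) : ℝ × ℝ → ℝ :=
  torusCell.indicator fun ξ => (1 - defect ξ / 100) ^ n

theorem measurableSet_torusCell : MeasurableSet torusCell :=
  measurableSet_Ioc.prod measurableSet_Ioc

theorem measurable_cellMultiplier (n : ℕ) : Measurable (cellMultiplier n) :=
  Measurable.indicator (by have := continuous_defect; fun_prop) measurableSet_torusCell

theorem torusCell_mem_nhds : torusCell ∈ 𝓝 (0 : ℝ × ℝ) :=
  prod_mem_nhds (Ioc_mem_nhds (by simp [Real.pi_pos]) Real.pi_pos)
    (Ioc_mem_nhds (by simp [Real.pi_pos]) Real.pi_pos)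

theorem cellMultiplier_nonneg (n : ℕ) (ξ : ℝ × ℝ) : 0 ≤ cellMultiplier n ξ :=
  Set.indicator_nonneg (fun ξ _ => pow_nonneg (by linarith [defect_lt ξ]) n) ξ

theorem exists_cellMultiplier_le :
    ∃ c : ℝ, 0 < c ∧ c ≤ 1 ∧ ∀ (n : ℕ) (ξ : ℝ × ℝ),
      cellMultiplier n ξ ≤ Real.exp (-(c * (n / 100 * symbolP ξ))) := by
  obtain ⟨c, hc, hc1, h⟩ := exists_mul_symbolP_le_defect
  refine ⟨c, hc, hc1, fun n ξ => ?_⟩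
  by_cases hξ : ξ ∈ torusCell
  swap
  · rw [cellMultiplier, Set.indicator_of_notMem hξ]
    exact (Real.exp_pos _).le
  rw [cellMultiplier, Set.indicator_of_mem hξ]
  have h1 := h ξ hξ
  have h2 : 1 - defect ξ / 100 ≤ Real.exp (-(c * symbolP ξ) / 100) := by
    have := Real.add_one_le_exp (-(c * symbolP ξ) / 100)
    linarith
  calc (1 - defect ξ / 100) ^ n ≤ Real.exp (-(c * symbolP ξ) / 100) ^ n :=
        pow_le_pow_left₀ (by linarith [defect_lt ξ]) h2 n
    _ = _ := by
      rw [← Real.exp_nat_mul]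
      congr 1
      ring

theorem integrable_cellMultiplier (n : ℕ) : Integrable (cellMultiplier n) :=
  (integrableOn_torusCell (by have := continuous_defect; fun_prop)).integrable_indicator
    measurableSet_torusCell

theorem rescaled_symbolP {n : ℕ} (hn : 1 ≤ n) (p : ℝ × ℝ) :
    (n : ℝ) / 100 * symbolP (straighten (scale n) p) =
      p.2 ^ 2 + (scale n ^ 2 * p.2 - p.1 ^ 2) ^ 4 := by
  rw [symbolP_straighten, ← mul_assoc, mul_scale_pow_eight hn, one_mul]

theorem tendsto_cellMultiplier (p : ℝ × ℝ) :
    Tendsto (fun n => cellMultiplier n (straighten (scale n) p)) atTop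
      (𝓝 (Real.exp (-(p.2 ^ 2 + p.1 ^ 8)))) := by
  have h1 := ((tendsto_defect_straighten p).comp tendsto_scale).neg
  have h2 : Tendsto (fun n : ℕ => (n : ℝ) * -(defect (straighten (scale n) p) / 100)) atTop
      (𝓝 (-(p.2 ^ 2 + p.1 ^ 8))) := by
    refine h1.congr' ?_
    filter_upwards [eventually_ge_atTop 1] with n hn
    have hs := mul_scale_pow_eight hn
    have hp := scale_pos hn
    simp only [Function.comp]
    rw [neg_eq_iff_eq_neg, div_eq_iff (by positivity)]
    linear_combination -(defect (straighten (scale n) p)) * hs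
  refine (Real.tendsto_one_add_pow_exp_of_tendsto h2).congr' ?_
  filter_upwards [((tendsto_straighten p).comp tendsto_scale).eventually_mem torusCell_mem_nhds]
    with n hn
  simp only [Function.comp] at hn
  rw [cellMultiplier, Set.indicator_of_mem hn, sub_eq_add_neg]

theorem tendsto_exp_neg_rescaled (p : ℝ × ℝ) :
    Tendsto (fun n : ℕ => Real.exp (-((n : ℝ) / 100 * symbolP (straighten (scale n) p)))) atTop
      (𝓝 (Real.exp (-(p.2 ^ 2 + p.1 ^ 8)))) := by
  have hc : Continuous fun b : ℝ => Real.exp (-(p.2 ^ 2 + (b ^ 2 * p.2 - p.1 ^ 2) ^ 4)) := by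
    fun_prop
  have h := ((hc.tendsto 0).mono_left (nhdsWithin_le_nhds (s := Set.Ioi 0))).comp tendsto_scale
  have h' : Tendsto (fun n => Real.exp (-(p.2 ^ 2 + (scale n ^ 2 * p.2 - p.1 ^ 2) ^ 4))) atTop
      (𝓝 (Real.exp (-(p.2 ^ 2 + p.1 ^ 8)))) := by
    rwa [show (0 ^ 2 * p.2 - p.1 ^ 2) ^ 4 = p.1 ^ 8 by ring] at h
  refine h'.congr' ?_
  filter_upwards [eventually_ge_atTop 1] with n hn
  rw [rescaled_symbolP hn]

/-- The `L¹` distance between `φ̂ⁿ` and `e^{-nP/100}`. -/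
noncomputable def multiplierError (n : ℕ) : ℝ :=
  ∫ ξ, |cellMultiplier n ξ - Real.exp (-((n : ℝ) / 100 * symbolP ξ))|

theorem tendsto_integral_exp_neg_rescaled :
    Tendsto (fun n : ℕ => ∫ p, Real.exp (-((n : ℝ) / 100 * symbolP (straighten (scale n) p))))
      atTop (𝓝 (2 * Real.Gamma (9 / 8) * Real.sqrt Real.pi)) := by
  rw [← integral_limit_profile]
  have hP := continuous_symbolP
  refine tendsto_integral_filter_of_dominated_convergence (gaussianMajorant 1)
    (Eventually.of_forall fun n => ?_) ?_ (integrable_gaussianMajorant one_pos)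
    (Eventually.of_forall tendsto_exp_neg_rescaled)
  · have := continuous_straighten (scale n)
    exact Continuous.aestronglyMeasurable (by fun_prop)
  · filter_upwards [eventually_ge_atTop 100] with n hn
    refine Eventually.of_forall fun p => ?_
    rw [Real.norm_of_nonneg (Real.exp_pos _).le, rescaled_symbolP (by omega)]
    simpa using exp_neg_le_gaussianMajorant (scale_pos (by omega : 1 ≤ n)).le (scale_le_one hn)
      zero_le_one p

theorem tendsto_integral_abs_sub_rescaled :
    Tendsto (fun n : ℕ => ∫ p, |cellMultiplier n (straighten (scale n) p) -
      Real.exp (-((n : ℝ) / 100 * symbolP (straighten (scale n) p)))|) atTop (𝓝 0) := by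
  obtain ⟨c, hc, hc1, hle⟩ := exists_cellMultiplier_le
  have hP := continuous_symbolP
  rw [show (0 : ℝ) = ∫ _ : ℝ × ℝ, (0 : ℝ) by simp]
  refine tendsto_integral_filter_of_dominated_convergence
    (fun p => gaussianMajorant c p + gaussianMajorant 1 p)
    (Eventually.of_forall fun n => ?_) ?_
    ((integrable_gaussianMajorant hc).add (integrable_gaussianMajorant one_pos))
    (Eventually.of_forall fun p => ?_)
  · have := continuous_straighten (scale n)
    have h1 : Measurable fun p => Real.exp (-((n : ℝ) / 100 * symbolP (straighten (scale n) p))) :=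
      Continuous.measurable (by fun_prop)
    have h2 := (measurable_cellMultiplier n).comp this.measurable
    exact (Measurable.sub h2 h1).abs.aestronglyMeasurable
  · filter_upwards [eventually_ge_atTop 100] with n hn
    refine Eventually.of_forall fun p => ?_
    have hb0 := (scale_pos (by omega : 1 ≤ n)).le
    have hb1 := scale_le_one hn
    have h1 := hle n (straighten (scale n) p)
    rw [rescaled_symbolP (by omega)] at h1 ⊢
    have h2 := h1.trans (exp_neg_le_gaussianMajorant hb0 hb1 hc.le p)
    have h3 := exp_neg_le_gaussianMajorant hb0 hb1 zero_le_one p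
    rw [one_mul] at h3
    rw [Real.norm_of_nonneg (abs_nonneg _)]
    refine (abs_sub _ _).trans (add_le_add ?_ ?_)
    · rwa [abs_of_nonneg (cellMultiplier_nonneg _ _)]
    · rwa [abs_of_nonneg (Real.exp_pos _).le]
  · have := ((tendsto_cellMultiplier p).sub (tendsto_exp_neg_rescaled p)).abs
    simpa using this

theorem natCast_rpow_mul_scale_pow_five {n : ℕ} (hn : 1 ≤ n) :
    (n : ℝ) ^ (5 / 8 : ℝ) * scale n ^ 5 = (100 : ℝ) ^ (5 / 8 : ℝ) := by
  have h : (0 : ℝ) < n := by positivity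
  rw [scale_pow_five hn, mul_left_comm, ← Real.rpow_add h]
  norm_num

theorem tendsto_rpow_mul_multiplierError :
    Tendsto (fun n : ℕ => (n : ℝ) ^ (5 / 8 : ℝ) * multiplierError n) atTop (𝓝 0) := by
  have h := tendsto_integral_abs_sub_rescaled.const_mul ((100 : ℝ) ^ (5 / 8 : ℝ))
  rw [mul_zero] at h
  refine h.congr' ?_
  filter_upwards [eventually_ge_atTop 1] with n hn
  symm
  rw [multiplierError, integral_straighten (scale_pos hn), smul_eq_mul, ← mul_assoc,
    natCast_rpow_mul_scale_pow_five hn]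

theorem tendsto_rpow_mul_integral_exp_neg_symbolP :
    Tendsto (fun n : ℕ => (n : ℝ) ^ (5 / 8 : ℝ) *
      ∫ ξ, Real.exp (-((n : ℝ) / 100 * symbolP ξ))) atTop
      (𝓝 ((100 : ℝ) ^ (5 / 8 : ℝ) * (2 * Real.Gamma (9 / 8) * Real.sqrt Real.pi))) := by
  refine (tendsto_integral_exp_neg_rescaled.const_mul ((100 : ℝ) ^ (5 / 8 : ℝ))).congr' ?_
  filter_upwards [eventually_ge_atTop 1] with n hn
  symm
  rw [integral_straighten (scale_pos hn), smul_eq_mul, ← mul_assoc,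
    natCast_rpow_mul_scale_pow_five hn]

/-! ### Asymptotics of the convolution powers -/

theorem convPow_phi_eq_integral (n : ℕ) (x : ℤ × ℤ) :
    convPow phi n x = 1 / (2 * (Real.pi : ℂ)) ^ 2 *
      ∫ ξ, (cellMultiplier n ξ : ℂ) * Complex.exp (-(Complex.I * (latticePairing x ξ : ℂ))) := by
  rw [convPow_eq_integral phi_support_finite, ← integral_indicator measurableSet_torusCell]
  congr 2
  funext ξ
  by_cases h : ξ ∈ torusCell
  · simp only [cellMultiplier, Set.indicator_of_mem h, fourierSymbol_phi, Complex.ofReal_pow]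
  · simp only [cellMultiplier, Set.indicator_of_notMem h, Complex.ofReal_zero, zero_mul]

theorem heatKernel_symbolP_eq (t : ℝ) (x : ℤ × ℤ) :
    heatKernel symbolP t (x.1, x.2) = 1 / (2 * (Real.pi : ℂ)) ^ 2 *
      ∫ ξ, (Real.exp (-(t * symbolP ξ)) : ℂ) *
        Complex.exp (-(Complex.I * (latticePairing x ξ : ℂ))) := by
  simp only [heatKernel, latticePairing, Complex.ofReal_exp, Complex.ofReal_neg]

theorem norm_exp_neg_I_mul (r : ℝ) : ‖Complex.exp (-(Complex.I * (r : ℂ)))‖ = 1 := by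
  rw [show -(Complex.I * (r : ℂ)) = ((-r : ℝ) : ℂ) * Complex.I by push_cast; ring,
    Complex.norm_exp_ofReal_mul_I]

theorem norm_one_div_two_pi_sq : ‖(1 / (2 * (Real.pi : ℂ)) ^ 2)‖ = 1 / (2 * Real.pi) ^ 2 := by
  rw [show (1 / (2 * (Real.pi : ℂ)) ^ 2) = ((1 / (2 * Real.pi) ^ 2 : ℝ) : ℂ) by push_cast; rfl,
    Complex.norm_of_nonneg (by positivity)]

/-- `L¹` closeness of the multipliers gives uniform closeness of the kernels. -/
theorem norm_convPow_sub_heatKernel_le {n : ℕ} (hn : 1 ≤ n) (x : ℤ × ℤ) :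
    ‖convPow phi n x - heatKernel symbolP ((n : ℝ) / 100) (x.1, x.2)‖ ≤
      1 / (2 * Real.pi) ^ 2 * multiplierError n := by
  have hphase : Continuous fun ξ => Complex.exp (-(Complex.I * (latticePairing x ξ : ℂ))) := by
    unfold latticePairing
    fun_prop
  have hint : ∀ {f : ℝ × ℝ → ℝ}, Integrable f → Integrable fun ξ =>
      (f ξ : ℂ) * Complex.exp (-(Complex.I * (latticePairing x ξ : ℂ))) := fun hf =>
    hf.ofReal.mul_bdd (c := 1) hphase.aestronglyMeasurable
      (Eventually.of_forall fun ξ => (norm_exp_neg_I_mul _).le)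
  rw [convPow_phi_eq_integral, heatKernel_symbolP_eq, ← mul_sub, norm_mul, norm_one_div_two_pi_sq,
    ← integral_sub (hint (integrable_cellMultiplier n))
      (hint (integrable_exp_neg_symbolP (by positivity)))]
  refine mul_le_mul_of_nonneg_left ((norm_integral_le_integral_norm _).trans_eq ?_) (by positivity)
  refine integral_congr_ae (Eventually.of_forall fun ξ => ?_)
  simp only
  rw [← sub_mul, norm_mul, norm_exp_neg_I_mul, mul_one, ← Complex.ofReal_sub, Complex.norm_real,
    Real.norm_eq_abs]

theorem norm_heatKernel_symbolP_le (t : ℝ) (x : ℤ × ℤ) :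
    ‖heatKernel symbolP t (x.1, x.2)‖ ≤
      1 / (2 * Real.pi) ^ 2 * ∫ ξ, Real.exp (-(t * symbolP ξ)) := by
  rw [heatKernel_symbolP_eq, norm_mul, norm_one_div_two_pi_sq]
  refine mul_le_mul_of_nonneg_left ((norm_integral_le_integral_norm _).trans_eq ?_) (by positivity)
  refine integral_congr_ae (Eventually.of_forall fun ξ => ?_)
  simp only
  rw [norm_mul, norm_exp_neg_I_mul, mul_one, Complex.norm_of_nonneg (Real.exp_pos _).le]

theorem norm_heatKernel_symbolP_zero (t : ℝ) :
    ‖heatKernel symbolP t (((0 : ℤ × ℤ).1 : ℝ), ((0 : ℤ × ℤ).2 : ℝ))‖ =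
      1 / (2 * Real.pi) ^ 2 * ∫ ξ, Real.exp (-(t * symbolP ξ)) := by
  rw [heatKernel_symbolP_eq, norm_mul, norm_one_div_two_pi_sq]
  simp only [latticePairing, Prod.fst_zero, Prod.snd_zero, Int.cast_zero, zero_mul, add_zero,
    Complex.ofReal_zero, mul_zero, neg_zero, Complex.exp_zero, mul_one]
  rw [integral_complex_ofReal, Complex.norm_of_nonneg]
  exact integral_nonneg fun ξ => (Real.exp_pos _).le

/-- The supremum of the heat kernel is its value at the origin. -/
theorem abs_supNorm_sub_le {n : ℕ} (hn : 1 ≤ n) :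
    |supNorm (convPow phi n) -
      1 / (2 * Real.pi) ^ 2 * ∫ ξ, Real.exp (-((n : ℝ) / 100 * symbolP ξ))| ≤
      1 / (2 * Real.pi) ^ 2 * multiplierError n := by
  have hup : supNorm (convPow phi n) ≤
      1 / (2 * Real.pi) ^ 2 * (∫ ξ, Real.exp (-((n : ℝ) / 100 * symbolP ξ))) +
        1 / (2 * Real.pi) ^ 2 * multiplierError n := by
    refine ciSup_le fun x => ?_
    have h1 := norm_convPow_sub_heatKernel_le hn x
    have h2 := norm_heatKernel_symbolP_le ((n : ℝ) / 100) x
    have h3 := norm_le_norm_add_norm_sub' (convPow phi n x)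
      (heatKernel symbolP ((n : ℝ) / 100) (x.1, x.2))
    linarith
  have hlow : ‖convPow phi n 0‖ ≤ supNorm (convPow phi n) :=
    le_ciSup (bddAbove_norm_convPow_phi n) 0
  have h1 := norm_convPow_sub_heatKernel_le hn 0
  have h2 := norm_heatKernel_symbolP_zero ((n : ℝ) / 100)
  have h3 := norm_sub_norm_le (heatKernel symbolP ((n : ℝ) / 100)
    (((0 : ℤ × ℤ).1 : ℝ), ((0 : ℤ × ℤ).2 : ℝ))) (convPow phi n 0)
  rw [norm_sub_rev] at h3
  rw [abs_le]
  constructor <;> linarith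

theorem tendsto_rpow_mul_supNorm :
    Tendsto (fun n : ℕ => (n : ℝ) ^ (5 / 8 : ℝ) * supNorm (convPow phi n)) atTop
      (𝓝 ((100 : ℝ) ^ (5 / 8 : ℝ) / (2 * Real.pi ^ (3 / 2 : ℝ)) * Real.Gamma (9 / 8))) := by
  have h1 := tendsto_rpow_mul_integral_exp_neg_symbolP.const_mul (1 / (2 * Real.pi) ^ 2)
  have h2 := tendsto_rpow_mul_multiplierError.const_mul (1 / (2 * Real.pi) ^ 2)
  rw [mul_zero] at h2
  have h3 : Tendsto (fun n : ℕ => (n : ℝ) ^ (5 / 8 : ℝ) * (supNorm (convPow phi n) -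
      1 / (2 * Real.pi) ^ 2 * ∫ ξ, Real.exp (-((n : ℝ) / 100 * symbolP ξ)))) atTop (𝓝 0) := by
    refine squeeze_zero_norm' ?_ h2
    filter_upwards [eventually_ge_atTop 1] with n hn
    have hpos : (0 : ℝ) ≤ (n : ℝ) ^ (5 / 8 : ℝ) := by positivity
    rw [norm_mul, Real.norm_of_nonneg hpos, mul_left_comm]
    exact mul_le_mul_of_nonneg_left (abs_supNorm_sub_le hn) hpos
  have h4 := h3.add h1
  have hpi := Real.pi_pos
  have hpow : Real.pi ^ (3 / 2 : ℝ) = Real.pi * Real.sqrt Real.pi := by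
    rw [Real.sqrt_eq_rpow, show (3 / 2 : ℝ) = 1 + 1 / 2 by norm_num, Real.rpow_add hpi,
      Real.rpow_one]
  have hsq : Real.sqrt Real.pi ^ 2 = Real.pi := Real.sq_sqrt hpi.le
  have hs : 0 < Real.sqrt Real.pi := Real.sqrt_pos.2 hpi
  convert h4 using 2
  · ring
  · rw [hpow, zero_add]
    generalize (100 : ℝ) ^ (5 / 8 : ℝ) = a
    generalize Real.Gamma (9 / 8) = g
    field_simp
    linear_combination -(a * g) * hsq

theorem supNorm_convPow_phi_pos (n : ℕ) : 0 < supNorm (convPow phi n) := by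
  refine lt_of_lt_of_le ?_ (le_ciSup (bddAbove_norm_convPow_phi n) 0)
  have hval : convPow phi n 0 = ((1 / (2 * Real.pi) ^ 2 * ∫ ξ, cellMultiplier n ξ : ℝ) : ℂ) := by
    rw [convPow_phi_eq_integral]
    simp only [latticePairing, Prod.fst_zero, Prod.snd_zero, Int.cast_zero, zero_mul, add_zero,
      Complex.ofReal_zero, mul_zero, neg_zero, Complex.exp_zero, mul_one]
    rw [integral_complex_ofReal]
    push_cast
    rfl
  have hpos : 0 < ∫ ξ, cellMultiplier n ξ := by
    rw [integral_pos_iff_support_of_nonneg (cellMultiplier_nonneg n) (integrable_cellMultiplier n)]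
    refine (Measure.measure_pos_of_mem_nhds volume torusCell_mem_nhds).trans_le
      (measure_mono fun ξ hξ => ?_)
    rw [Function.mem_support, cellMultiplier, Set.indicator_of_mem hξ]
    exact pow_ne_zero n (by linarith [defect_lt ξ])
  rw [hval, Complex.norm_of_nonneg (by positivity)]
  positivity

/-- A positive sequence with a positive limit is bounded above and away from zero. -/
theorem exists_bounds_of_tendsto_pos {a : ℕ → ℝ} {L : ℝ} (hL : 0 < L) (ha : ∀ n, 0 < a n)
    (h : Tendsto a atTop (𝓝 L)) : ∃ C C' : ℝ, 0 < C ∧ 0 < C' ∧ ∀ n, C ≤ a n ∧ a n ≤ C' := by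
  obtain ⟨M, hM⟩ := h.bddAbove_range
  obtain ⟨M', hM'⟩ := (h.inv₀ hL.ne').bddAbove_range
  have h1 : ∀ n, a n ≤ M := fun n => hM ⟨n, rfl⟩
  have h2 : ∀ n, (a n)⁻¹ ≤ M' := fun n => hM' ⟨n, rfl⟩
  exact ⟨M'⁻¹, M, inv_pos.2 ((inv_pos.2 (ha 0)).trans_le (h2 0)), (ha 0).trans_le (h1 0),
    fun n => ⟨inv_le_of_inv_le₀ (ha n) (h2 n), h1 n⟩⟩

theorem mainTheorem6 :
    (∀ t : ℝ, 0 < t → Integrable (fun ξ : ℝ × ℝ => Real.exp (-(t * symbolP ξ)))) ∧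
    (∀ ε : ℝ, 0 < ε → ∃ N : ℕ, ∀ n : ℕ, N ≤ n → ∀ x : ℤ × ℤ,
      ‖convPow phi n x - heatKernel symbolP ((n : ℝ) / 100) ((x.1 : ℝ), (x.2 : ℝ))‖
        < ε * (n : ℝ) ^ (-(5 / 8) : ℝ)) ∧
    (∃ C C' : ℝ, 0 < C ∧ 0 < C' ∧ ∀ n : ℕ, 1 ≤ n →
      C * (n : ℝ) ^ (-(5 / 8) : ℝ) ≤ supNorm (convPow phi n) ∧
        supNorm (convPow phi n) ≤ C' * (n : ℝ) ^ (-(5 / 8) : ℝ)) ∧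
    Tendsto (fun n : ℕ => (n : ℝ) ^ (5 / 8 : ℝ) * supNorm (convPow phi n)) atTop
      (𝓝 ((100 : ℝ) ^ (5 / 8 : ℝ) / (2 * Real.pi ^ (3 / 2 : ℝ)) * Real.Gamma (9 / 8))) := by
  have hrpow : ∀ n : ℕ, 1 ≤ n →
      0 < (n : ℝ) ^ (5 / 8 : ℝ) ∧ (n : ℝ) ^ (-(5 / 8) : ℝ) = ((n : ℝ) ^ (5 / 8 : ℝ))⁻¹ :=
    fun n hn => ⟨Real.rpow_pos_of_pos (by positivity) _, Real.rpow_neg (by positivity) _⟩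
  refine ⟨fun t ht => integrable_exp_neg_symbolP ht, fun ε hε => ?_, ?_, tendsto_rpow_mul_supNorm⟩
  · have h := tendsto_rpow_mul_multiplierError.const_mul (1 / (2 * Real.pi) ^ 2)
    rw [mul_zero] at h
    obtain ⟨N, hN⟩ := eventually_atTop.1 ((h.eventually (gt_mem_nhds hε)).and
      (eventually_ge_atTop 1))
    refine ⟨N, fun n hn x => ?_⟩
    obtain ⟨hlt, hn1⟩ := hN n hn
    obtain ⟨hpos, hneg⟩ := hrpow n hn1
    refine (norm_convPow_sub_heatKernel_le hn1 x).trans_lt ?_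
    rw [hneg, ← div_eq_mul_inv, lt_div_iff₀ hpos]
    linarith
  · obtain ⟨C, C', hC, hC', h⟩ := exists_bounds_of_tendsto_pos
      (mul_pos (by positivity) (Real.Gamma_pos_of_pos (by norm_num)))
      (fun n => mul_pos (hrpow (n + 1) (by omega)).1 (supNorm_convPow_phi_pos (n + 1)))
      ((tendsto_add_atTop_iff_nat 1).2 tendsto_rpow_mul_supNorm)
    refine ⟨C, C', hC, hC', fun n hn => ?_⟩
    obtain ⟨m, rfl⟩ := Nat.exists_eq_add_of_le' hn
    obtain ⟨hpos, hneg⟩ := hrpow (m + 1) hn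
    obtain ⟨h1, h2⟩ := h m
    rw [hneg, ← div_eq_mul_inv, ← div_eq_mul_inv, div_le_iff₀ hpos, le_div_iff₀ hpos]
    exact ⟨by linarith, by linarith⟩
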